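/- **Fluid.** Let $p\in C^{1,\alpha}_{\mathrm{loc}}([0,\infty))$, $0<\alpha<1$, be twice differentiable on $(0,\infty)$ with $p'(\rho)>0$ and $2p'(\rho)+\rho p''(\rho)>0$ for $\rho>0$, let $g>0$, $\bar\rho_0>0$, $h(\rho)=\int_{\bar\rho_0}^{\rho}\frac{p'(s)}{s}\,ds$ and $x_2^{st}=\frac{p'(\bar\rho_0)}{2g}$. The critical density $\rho_{cr,X}$ at height $X$ is the solution of $\frac{p'(\rho)}2+h(\rho)+gX=\frac{p'(\bar\rho_0)}2$. Let $\rho(T;X)$ be the solution $\rho>0$ of $2\rho^2\bigl(\frac{p'(\bar\rho_0)}2-h(\rho)-gX\bigr)=T$ that is subsonic, i.e. $\frac{p'(\rho)}2+h(\rho)+gX>\frac{p'(\bar\rho_0)}2$. Put $H(t;s)=\rho(2\bar\rho_0^2gt;\,x_2^{st}-s)$, $F(t;s)=\int_0^t\frac{d\tau}{H(\tau;s)}$, and $\lambda(s)=2s\,\partial_1F(s;s)-F(s;s)$. **Solutions.** Let $\Omega\subset\{x\in\mathbb R^2:x_1\ge0\}$ be connected and relatively open. Put $L^2_{w,loc}(\Omega)=\{v:\int_K\frac{|v|^2}{x_1}dx<\infty\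 \forall K\subset\subset\Omega\}$, and let $W^{1,2}_{w,loc}(\Omega)$ be the set of $v\in L^2_{w,loc}(\Omega)$ with weak derivatives in $L^2_{w,loc}(\Omega)$. A *subsonic variational solution* of $$\operatorname{div}\Bigl(\frac{\nabla u}{x_1H(|\nabla u|^2/x_1^2;x_2)}\Bigr)=0\ \text{ in }\Omega\cap\{u>0\},\qquad \frac{|\nabla u|^2}{x_1^2}=x_2\ \text{ on }\Omega\cap\partial\{u>0\}$$ is a function $u\in W^{1,2}_{w,loc}(\Omega)$ such that: 1. $u\ge0$ in $\Omega$ and $u=0$ on $\Omega\cap\{x_1=0\}$; 2. $u\in C^0(\Omega)\cap C^2(\Omega\cap\{u>0\})$; 3. for every $\bar x\in\Omega\cap\{x_1=0\}$, as $x\to \bar x$ in $\Omega\cap\{u>0\}$, $\frac1{x_1}\partial_2u\to0$ and $\frac1{x_1}\partial_1u$ has a finite limit; 4. for every compact $K\subset\Omega$ there is $\varepsilon_0>0$ with $H\bigl(\frac{|\nabla u|^2}{x_1^2};x_2\bigr)-\rho_{cr,\,x_2^{st}-x_2}\ge\varepsilon_0$ in $K\cap\{u>0\}$; 5. $\Omega\cap\partial\{u>0\}\subset\{x_1\ge0,\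 x_2\ge0\}$; 6. with $t=\frac{|\nabla u|^2}{x_1^2}$ and $\chi=\chi_{\{u>0\}}$, for all $\phi\in C^1_0(\Omega;\mathbb R^2)$ with $\phi_1=0$ on $\{x_1=0\}$, $$\begin{aligned}0={}&\int_\Omega x_1[F(t;x_2)+\lambda(x_2)\chi]\operatorname{div}\phi\,dx-2\int_\Omega\frac{\partial_1F(t;x_2)}{x_1}\nabla u\,D\phi\,\nabla u\,dx\\&+\int_\Omega[F(t;x_2)-2t\,\partial_1F(t;x_2)+\lambda(x_2)\chi]\phi_1\,dx+\int_\Omega x_1[\partial_2F(t;x_2)+\lambda'(x_2)\chi]\phi_2\,dx.\end{aligned}$$ It is a *subsonic weak solution* if moreover $\Omega\cap\partial\{u>0\}\cap\{x_1>0\}\cap\{x_2\ne0\}$ is locally a $C^{2,\beta}$ curve for some $\beta\in(0,1)$. **Proposition.** Let $u$ be a subsonic weak solution, and let $x^\circ=(0,x_2^\circ)\in\Omega\cap\partial\{u>0\}$ with $0<x_2^\circ<x_2^{st}$. Write $B_r^+(x^\circ)=\{x:x_1>0,\ |x-x^\circ|<r\}$. Suppose that, for some $C$ and $r>0$, $$\Bigl|\frac{|\nabla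 u|^2}{x_1^2}-x_2\Bigr|\le Cx_1\quad\text{in }B_r^+(x^\circ)\cap\{u>0\}.$$ Suppose also that near $x^\circ$ the set $(\Omega\cap\partial\{u>0\}\cap\{x_1>0\})\cup\{x^\circ\}$ coincides with the image of a continuous injective curve $\sigma=(\sigma_1,\sigma_2):I\to\mathbb R^2$ with $\sigma(0)=x^\circ$, where $I\ni0$ is an interval, oriented so that it contains positive numbers. Let $$M(r)=r^{-3}\int_{B_r^+(x^\circ)}x_1[F(t;x_2)+\lambda(x_2)\chi]\,dx-2r^{-4}\int_{\{x_1>0,\,|x-x^\circ|=r\}}\frac{u^2}{x_1\bar\rho_0}\,d\mathcal H^1,\qquad M(0^+)=\lim_{r\to0^+}M(r).$$ * If $M(0^+)=\frac{2x_2^\circ}{3\bar\rho_0}$ (density $2/3$), then for some $t_1>0$ one of the following holds. Either $x^\circ$ is an end point of the curve, i.e. $I\subset[0,\infty)$, and $(0,t_1)\subset I$, $\sigma_2\ne x_2^\circ$ in $(0,t_1)$ and $\lim_{t\to0^+}\frac{\sigma_1(t)}{\sigma_2(t)-x_2^\circ}=0$ (an upward or downward cusp). Or $(-t_1,t_1)\subset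 I$, $\sigma_2\neq x_2^\circ$ in $(-t_1,t_1)\setminus\{0\}$, $\sigma_2-x_2^\circ$ changes sign at $t=0$ and $\lim_{t\to0}\frac{\sigma_1(t)}{\sigma_2(t)-x_2^\circ}=0$ (a double cusp). * If $M(0^+)=0$ (density $0$), then for some $t_1>0$ one has $(-t_1,t_1)\subset I$, $\sigma_2\ne x_2^\circ$ in $(-t_1,t_1)\setminus\{0\}$ and $\lim_{t\to0}\frac{\sigma_1(t)}{\sigma_2(t)-x_2^\circ}=0$. -/

import Mathlib

open Set Filter Topology MeasureTheory
open scoped NNReal ContDiff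

namespace AxisFlow

noncomputable section

/-- The plane of the variables `(x₁, x₂)`, with the Euclidean norm;
`x 0` is `x₁` (distance to the axis) and `x 1` is `x₂`. -/
abbrev Plane : Type := EuclideanSpace ℝ (Fin 2)

/-! ### The fluid -/

/-- A compressible fluid in a gravity field: the pressure law `p = p(ρ)`, which is `C^{1,α}` on
`[0, ∞)` (with the Hölder bound on bounded sets), twice differentiable on `(0, ∞)`, with `p' > 0`
and `2 p' + ρ p'' > 0` on `(0, ∞)`; the gravity constant `g > 0`; and the constant density
`rho0 > 0` on the free surface. -/
structure Fluid where
  p : ℝ → ℝ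
  α : ℝ≥0
  g : ℝ
  rho0 : ℝ
  α_pos : 0 < α
  α_lt_one : α < 1
  g_pos : 0 < g
  rho0_pos : 0 < rho0
  differentiable : DifferentiableOn ℝ p (Ici 0)
  holder : ∀ R : ℝ, 0 < R → ∃ C : ℝ≥0, HolderOnWith C α (derivWithin p (Ici 0)) (Icc 0 R)
  differentiable_deriv : DifferentiableOn ℝ (derivWithin p (Ici 0)) (Ioi 0)
  deriv_pos : ∀ ρ : ℝ, 0 < ρ → 0 < derivWithin p (Ici 0) ρ
  convexity : ∀ ρ : ℝ, 0 < ρ →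
    0 < 2 * derivWithin p (Ici 0) ρ + ρ * deriv (derivWithin p (Ici 0)) ρ

namespace Fluid

variable (fl : Fluid)

/-- The derivative `p'` on `[0, ∞)`. -/
def dp (ρ : ℝ) : ℝ := derivWithin fl.p (Ici 0) ρ

/-- The enthalpy `h(ρ) = ∫_{rho0}^ρ p'(s)/s ds`. -/
def enthalpy (ρ : ℝ) : ℝ := ∫ s in fl.rho0..ρ, fl.dp s / s

/-- The stagnation height `x₂ˢᵗ = p'(rho0) / (2 g)`, where the speed on the free surface vanishes. -/
def stagnationHeight : ℝ := fl.dp fl.rho0 / (2 * fl.g)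

/-- `ρ` is a critical density at height `X₂`:
`p'(ρ)/2 + h(ρ) + g X₂ = p'(rho0)/2` (the speed given by Bernoulli's law is the sound speed). -/
def IsCritical (X₂ ρ : ℝ) : Prop :=
  0 < ρ ∧ fl.dp ρ / 2 + fl.enthalpy ρ + fl.g * X₂ = fl.dp fl.rho0 / 2

/-- The local critical density at height `X₂`; `ρ ↦ p'(ρ)/2 + h(ρ)` is strictly increasing, so
there is at most one. -/
def criticalDensity (X₂ : ℝ) : ℝ :=
  open scoped Classical in if h : ∃ ρ, fl.IsCritical X₂ ρ then h.choose else 0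

/-- `ρ` solves Bernoulli's law `2 ρ² (p'(rho0)/2 - h(ρ) - g X₂) = T` at height `X₂`, where
`T = |∇ψ|²/x₁²` is the squared momentum, and is subsonic, that is, larger than the critical
density (`p'(ρ)/2 + h(ρ) + g X₂ > p'(rho0)/2`). There is at most one such `ρ`. -/
def IsSubsonicDensity (T X₂ ρ : ℝ) : Prop :=
  0 < ρ ∧ 2 * ρ ^ 2 * (fl.dp fl.rho0 / 2 - fl.enthalpy ρ - fl.g * X₂) = T ∧
    fl.dp fl.rho0 / 2 < fl.dp ρ / 2 + fl.enthalpy ρ + fl.g * X₂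

/-- The density `ρ(T; X₂)` as a function of the squared momentum and of the height, on the
subsonic branch; `0` where there is no subsonic density. -/
def density (T X₂ : ℝ) : ℝ :=
  open scoped Classical in if h : ∃ ρ, fl.IsSubsonicDensity T X₂ ρ then h.choose else 0

/-- The density in the rescaled variables, `H(t; s) = ρ(2 rho0² g t; x₂ˢᵗ - s)`. -/
def H (t s : ℝ) : ℝ := fl.density (2 * fl.rho0 ^ 2 * fl.g * t) (fl.stagnationHeight - s)

/-- `F(t; s) = ∫₀ᵗ dτ / H(τ; s)`. -/
def F (t s : ℝ) : ℝ := ∫ τ in (0 : ℝ)..t, 1 / fl.H τ s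

/-- `∂₁F(t; s) = 1 / H(t; s)`. -/
def F₁ (t s : ℝ) : ℝ := 1 / fl.H t s

/-- `∂₂F(t; s)`. -/
def F₂ (t s : ℝ) : ℝ := deriv (fun s' => fl.F t s') s

/-- `Φ(t; s) = 2 t ∂₁F(t; s) - F(t; s)`. -/
def Phi (t s : ℝ) : ℝ := 2 * t * fl.F₁ t s - fl.F t s

/-- `λ(s) = Φ(s; s)`. -/
def lam (s : ℝ) : ℝ := fl.Phi s s

end Fluid

/-! ### Sets, gradients, weighted Sobolev space -/

/-- `B_r⁺(x°)`. -/
def halfBall (x₀ : Plane) (r : ℝ) : Set Plane := {x | 0 < x 0} ∩ Metric.ball x₀ r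

/-- `Ω` is connected and relatively open in the closed right half-plane. -/
def IsHalfPlaneDomain (Ω : Set Plane) : Prop :=
  IsConnected Ω ∧ ∃ O : Set Plane, IsOpen O ∧ Ω = O ∩ {x | 0 ≤ x 0}

/-- The fluid phase `Ω ∩ {u > 0}`. -/
def posSet (Ω : Set Plane) (u : Plane → ℝ) : Set Plane := {x | x ∈ Ω ∧ 0 < u x}

/-- The topological free boundary `Ω ∩ ∂{u > 0}`. -/
def freeBoundary (Ω : Set Plane) (u : Plane → ℝ) : Set Plane := Ω ∩ frontier (posSet Ω u)

/-- The gradient of `u`: classical in the fluid phase (where `u` is `C²`), zero elsewhere. The weak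
gradient of a Sobolev function vanishes a.e. on `{u = 0}`, so this represents it. -/
def grad (Ω : Set Plane) (u : Plane → ℝ) : Plane → Plane :=
  (posSet Ω u).indicator (gradient u)

/-- `t = |∇u|² / x₁²`. -/
def momSq (Ω : Set Plane) (u : Plane → ℝ) (x : Plane) : ℝ := ‖grad Ω u x‖ ^ 2 / x 0 ^ 2

/-- The characteristic function of `{u > 0}`. -/
def chi (Ω : Set Plane) (u : Plane → ℝ) : Plane → ℝ := (posSet Ω u).indicator (fun _ => 1)

/-- `v ∈ L²_{w,loc}(Ω)`, with weight `1 / x₁`. -/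
def MemL2wLoc (Ω : Set Plane) (v : Plane → ℝ) : Prop :=
  AEStronglyMeasurable v (volume.restrict Ω) ∧
    ∀ K : Set Plane, IsCompact K → K ⊆ Ω → IntegrableOn (fun x => 1 / x 0 * |v x| ^ 2) K

/-- `G` is the weak `i`-th partial derivative of `u` in the interior `Ω ∩ {x₁ > 0}`. -/
def IsWeakPartial (Ω : Set Plane) (i : Fin 2) (u G : Plane → ℝ) : Prop :=
  ∀ η : Plane → ℝ, ContDiff ℝ ∞ η → HasCompactSupport η → tsupport η ⊆ Ω ∩ {x | 0 < x 0} →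
    ∫ x in Ω, u x * gradient η x i = - ∫ x in Ω, G x * η x

/-- `u ∈ W^{1,2}_{w,loc}(Ω)`. -/
def MemW12wLoc (Ω : Set Plane) (u : Plane → ℝ) : Prop :=
  MemL2wLoc Ω u ∧ ∀ i : Fin 2, ∃ G : Plane → ℝ, IsWeakPartial Ω i u G ∧ MemL2wLoc Ω G

/-! ### The first domain variation -/

/-- `div φ`. -/
def divergence (φ : Plane → Plane) (x : Plane) : ℝ :=
  ∑ i : Fin 2, fderiv ℝ φ x (EuclideanSpace.single i 1) i

/-- The first domain variation of `∫ x₁ [F(|∇u|²/x₁²; x₂) + λ(x₂) χ_{u>0}] dx` in the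
direction `φ` (up to the sign). -/
def firstVariation (fl : Fluid) (Ω : Set Plane) (u : Plane → ℝ) (φ : Plane → Plane) : ℝ :=
  (∫ x in Ω, x 0 * (fl.F (momSq Ω u x) (x 1) + fl.lam (x 1) * chi Ω u x) * divergence φ x)
  - 2 * (∫ x in Ω, fl.F₁ (momSq Ω u x) (x 1) * (1 / x 0) *
      inner ℝ (grad Ω u x) (fderiv ℝ φ x (grad Ω u x)))
  + (∫ x in Ω, (fl.F (momSq Ω u x) (x 1) - 2 * fl.F₁ (momSq Ω u x) (x 1) * momSq Ω u x
      + fl.lam (x 1) * chi Ω u x) * φ x 0)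
  + ∫ x in Ω, x 0 * (fl.F₂ (momSq Ω u x) (x 1) + deriv fl.lam (x 1) * chi Ω u x) * φ x 1

/-! ### Notions of solution -/

/-- Subsonic variational solutions in `Ω` of
`div (∇u / (x₁ H(|∇u|²/x₁²; x₂))) = 0` in `{u > 0}`, `|∇u|²/x₁² = x₂` on `∂{u > 0}`. -/
structure IsVariationalSolution (fl : Fluid) (Ω : Set Plane) (u : Plane → ℝ) : Prop where
  sobolev : MemW12wLoc Ω u
  nonneg : ∀ x ∈ Ω, 0 ≤ u x
  zero_on_axis : ∀ x ∈ Ω, x 0 = 0 → u x = 0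
  continuousOn : ContinuousOn u Ω
  contDiffOn : ContDiffOn ℝ 2 u (posSet Ω u)
  compatibility : ∀ x₀ ∈ Ω, x₀ 0 = 0 →
    Tendsto (fun x => 1 / x 0 * gradient u x 1) (𝓝[posSet Ω u] x₀) (𝓝 0) ∧
    ∃ l : ℝ, Tendsto (fun x => 1 / x 0 * gradient u x 0) (𝓝[posSet Ω u] x₀) (𝓝 l)
  subsonic : ∀ K : Set Plane, IsCompact K → K ⊆ Ω → ∃ ε : ℝ, 0 < ε ∧ ∀ x ∈ K ∩ posSet Ω u,
    ε ≤ fl.H (momSq Ω u x) (x 1) - fl.criticalDensity (fl.stagnationHeight - x 1)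
  surface : freeBoundary Ω u ⊆ {x | 0 ≤ x 0 ∧ 0 ≤ x 1}
  variation : ∀ φ : Plane → Plane, ContDiff ℝ 1 φ → HasCompactSupport φ →
    tsupport φ ∩ {x | 0 ≤ x 0} ⊆ Ω → (∀ x : Plane, x 0 = 0 → φ x 0 = 0) →
    firstVariation fl Ω u φ = 0

/-- `S` is locally a `C^{2,β}` curve: near each of its points it is the graph, over one of the
coordinates, of a `C^{2,β}` function. -/
def IsLocallyC2HolderCurve (β : ℝ≥0) (S : Set Plane) : Prop :=
  ∀ x ∈ S, ∃ V : Set Plane, IsOpen V ∧ x ∈ V ∧ ∃ i j : Fin 2, i ≠ j ∧ ∃ f : ℝ → ℝ,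
    ContDiff ℝ 2 f ∧ (∃ C : ℝ≥0, HolderWith C β (deriv (deriv f))) ∧
    S ∩ V = {y | y ∈ V ∧ y j = f (y i)}

/-- Subsonic weak solutions: variational solutions whose free boundary is locally a `C^{2,β}` curve
away from the axis and from the stagnation level. -/
structure IsWeakSolution (fl : Fluid) (Ω : Set Plane) (u : Plane → ℝ) : Prop
    extends IsVariationalSolution fl Ω u where
  regular : ∃ β : ℝ≥0, 0 < β ∧ β < 1 ∧
    IsLocallyC2HolderCurve β (freeBoundary Ω u ∩ {x | 0 < x 0 ∧ x 1 ≠ 0})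

/-! ### Non-stagnation axis points -/

/-- The set `A^u` of non-stagnation axis points. -/
def axisPoints (Ω : Set Plane) (u : Plane → ℝ) : Set Plane :=
  {x | x ∈ freeBoundary Ω u ∧ x 0 = 0 ∧ 0 < x 1}

/-- The growth assumption `| |∇u|²/x₁² - x₂ | ≤ C |x₁ - x₁°|` in the fluid near `x°`. -/
def GrowthAt (Ω : Set Plane) (u : Plane → ℝ) (x₀ : Plane) : Prop :=
  ∃ C r : ℝ, 0 < r ∧ ∀ x ∈ halfBall x₀ r ∩ posSet Ω u,
    |momSq Ω u x - x 1| ≤ C * |x 0 - x₀ 0|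

/-- `I(r) = ∫_{B_r⁺(x°)} x₁ [F(|∇u|²/x₁²; x₂) + λ(x₂) χ_{u>0}] dx`. -/
def energyI (fl : Fluid) (Ω : Set Plane) (u : Plane → ℝ) (x₀ : Plane) (r : ℝ) : ℝ :=
  ∫ x in halfBall x₀ r, x 0 * (fl.F (momSq Ω u x) (x 1) + fl.lam (x 1) * chi Ω u x)

/-- The point `x° + r (cos θ, sin θ)`. -/
def arcPoint (x₀ : Plane) (r θ : ℝ) : Plane := !₂[x₀ 0 + r * Real.cos θ, x₀ 1 + r * Real.sin θ]

/-- `J(r) = ∫_{∂B_r⁺(x°)} u² / (x₁ rho0) dℋ¹`, for `x°` on the axis: the half circle is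
parametrized by the angle, with arc length `r dθ`. -/
def energyJ (fl : Fluid) (u : Plane → ℝ) (x₀ : Plane) (r : ℝ) : ℝ :=
  ∫ θ in (-(Real.pi / 2))..(Real.pi / 2),
    1 / (arcPoint x₀ r θ 0 * fl.rho0) * u (arcPoint x₀ r θ) ^ 2 * r

/-- `M^{x₁}(r) = r⁻³ I(r) - 2 r⁻⁴ J(r)`. -/
def weissM (fl : Fluid) (Ω : Set Plane) (u : Plane → ℝ) (x₀ : Plane) (r : ℝ) : ℝ :=
  energyI fl Ω u x₀ r / r ^ 3 - 2 * energyJ fl u x₀ r / r ^ 4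

/-- Near `x°`, the free boundary in `{x₁ > 0}`, completed by the point `x°`, is a continuous
injective curve `σ : I → ℝ²` with `σ(0) = x°`; the parameter is oriented so that `I` contains
positive numbers. -/
structure IsFreeBoundaryCurve (Ω : Set Plane) (u : Plane → ℝ) (x₀ : Plane)
    (I : Set ℝ) (σ : ℝ → Plane) : Prop where
  interval : I.OrdConnected
  zero_mem : (0 : ℝ) ∈ I
  exists_pos : ∃ t ∈ I, 0 < t
  continuousOn : ContinuousOn σ I
  injOn : InjOn σ I
  map_zero : σ 0 = x₀
  image : ∃ r : ℝ, 0 < r ∧ σ '' I ∩ Metric.ball x₀ r =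
    insert x₀ (freeBoundary Ω u ∩ {x | 0 < x 0}) ∩ Metric.ball x₀ r

end

end AxisFlow

/-!
The compatibility condition at the axis says that `∂₂u / x₁ → 0` and that `∂₁u / x₁` has a limit as
the axis point `x°` is approached in the fluid. By the growth assumption the square of that limit is
`x₂°`, and the limit is positive, because a function that vanishes on the axis and decreases in `x₁`
wherever it is positive is never positive (`IsVariationalSolution.tendsto_axial_speed`). So in the
fluid near `x°` the gradient of `u` is `x₁ (√x₂° e₁ + o(1))`, and `u` increases along all directions
of cones around `e₁` whose opening is as close to a half plane as desired. This monotonicity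
(`IsVariationalSolution.posSet_cone`) gives the geometry of the free boundary: for every `κ > 0` the
cone `κ |x₂ - x₂°| < x₁` is filled with fluid near `x°`, so that free boundary points satisfy
`x₁ ≤ κ |x₂ - x₂°|`, and each horizontal line meets the free boundary off the axis at most once.
The first fact says that the curve is tangent to the axis. By the second and injectivity, two
branches of the curve cannot lie on the same side of the height `x₂°`
(`IsFreeBoundaryCurve.cusp`).

The same monotonicity determines the density. The blow-up limit of `u` is `√x₂° x₁² / 2`, and the
fluid fills the half ball up to a set of relatively small measure. Where `t = x₂`, the energy density
`x₁ (F + λ)` is `2 x₂ x₁ / rho0`, and the inverse density `∂₁F = 1 / H` is monotone in `t`, which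
bounds the error for `t` close to `x₂`. Hence `M(0⁺) = 2 x₂° / (3 rho0)`
(`IsVariationalSolution.tendsto_weissM`); density `0` does not occur under the compatibility condition
at `x°`, and this settles the second assertion.
-/

namespace AxisFlow

/-! ### The subsonic branch of Bernoulli's law -/

namespace Fluid

variable (fl : Fluid)

lemma hasDerivAt_dp {ρ : ℝ} (hρ : 0 < ρ) : HasDerivAt fl.dp (deriv fl.dp ρ) ρ :=
  ((fl.differentiable_deriv ρ hρ).differentiableAt (Ioi_mem_nhds hρ)).hasDerivAt

lemma continuousOn_dp : ContinuousOn fl.dp (Ioi 0) :=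
  fun _ hρ => (fl.hasDerivAt_dp hρ).continuousAt.continuousWithinAt

lemma hasDerivAt_enthalpy {ρ : ℝ} (hρ : 0 < ρ) :
    HasDerivAt fl.enthalpy (fl.dp ρ / ρ) ρ := by
  have hc : ContinuousOn (fun s => fl.dp s / s) (Ioi 0) :=
    fl.continuousOn_dp.div continuousOn_id fun s hs => ne_of_gt hs
  have hsub : uIcc fl.rho0 ρ ⊆ Ioi 0 := fun s hs =>
    lt_of_lt_of_le (lt_min fl.rho0_pos hρ) hs.1
  exact intervalIntegral.integral_hasDerivAt_right (hc.mono hsub).intervalIntegrable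
    (hc.stronglyMeasurableAtFilter isOpen_Ioi ρ hρ) (hc.continuousAt (Ioi_mem_nhds hρ))

lemma continuousOn_enthalpy : ContinuousOn fl.enthalpy (Ioi 0) :=
  fun _ hρ => (fl.hasDerivAt_enthalpy hρ).continuousAt.continuousWithinAt

lemma enthalpy_rho0 : fl.enthalpy fl.rho0 = 0 := intervalIntegral.integral_same

lemma strictMonoOn_half_dp_add_enthalpy :
    StrictMonoOn (fun ρ => fl.dp ρ / 2 + fl.enthalpy ρ) (Ioi 0) := by
  refine strictMonoOn_of_deriv_pos (convex_Ioi 0)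
    ((fl.continuousOn_dp.div_const 2).add fl.continuousOn_enthalpy) fun ρ hρ => ?_
  rw [interior_Ioi] at hρ
  have hρ' : 0 < ρ := hρ
  have h := ((fl.hasDerivAt_dp hρ').div_const 2).add (fl.hasDerivAt_enthalpy hρ')
  have hd : deriv (fun ρ => fl.dp ρ / 2 + fl.enthalpy ρ) ρ = deriv fl.dp ρ / 2 + fl.dp ρ / ρ :=
    h.deriv
  have hcv : 0 < 2 * fl.dp ρ + ρ * deriv fl.dp ρ := fl.convexity ρ hρ'
  rw [hd, show deriv fl.dp ρ / 2 + fl.dp ρ / ρ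
    = (2 * fl.dp ρ + ρ * deriv fl.dp ρ) / (2 * ρ) by field_simp; ring]
  positivity

/-- The squared momentum that Bernoulli's law assigns to the density `ρ` at height `X`. -/
noncomputable def momentum (X ρ : ℝ) : ℝ :=
  2 * ρ ^ 2 * (fl.dp fl.rho0 / 2 - fl.enthalpy ρ - fl.g * X)

/-- The densities that are subsonic at height `X`. -/
def subsonicSet (X : ℝ) : Set ℝ :=
  {ρ | 0 < ρ ∧ fl.dp fl.rho0 / 2 < fl.dp ρ / 2 + fl.enthalpy ρ + fl.g * X}

variable {fl}

lemma mem_subsonicSet_of_le {X ρ ρ' : ℝ} (h : ρ ∈ fl.subsonicSet X) (hle : ρ ≤ ρ') :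
    ρ' ∈ fl.subsonicSet X := by
  have hpos : 0 < ρ' := h.1.trans_le hle
  have := fl.strictMonoOn_half_dp_add_enthalpy.monotoneOn h.1 hpos hle
  exact ⟨hpos, by linarith [h.2]⟩

lemma isSubsonicDensity_iff {T X ρ : ℝ} :
    fl.IsSubsonicDensity T X ρ ↔ ρ ∈ fl.subsonicSet X ∧ fl.momentum X ρ = T :=
  ⟨fun h => ⟨⟨h.1, h.2.2⟩, h.2.1⟩, fun h => ⟨h.1.1, h.2, h.1.2⟩⟩

lemma continuousOn_momentum (X : ℝ) : ContinuousOn (fl.momentum X) (Ioi 0) :=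
  (by fun_prop : ContinuousOn (fun ρ : ℝ => 2 * ρ ^ 2) (Ioi 0)).mul
    ((continuousOn_const.sub fl.continuousOn_enthalpy).sub continuousOn_const)

/-- On the subsonic branch the momentum is a strictly decreasing function of the density. -/
lemma momentum_strictAntiOn (X : ℝ) : StrictAntiOn (fl.momentum X) (fl.subsonicSet X) := by
  intro a ha b hb hab
  refine strictAntiOn_of_deriv_neg (convex_Icc a b)
    ((continuousOn_momentum X).mono fun s hs => ha.1.trans_le hs.1) ?_
    (left_mem_Icc.2 hab.le) (right_mem_Icc.2 hab.le) hab
  intro ρ hρ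
  rw [interior_Icc] at hρ
  have hs := mem_subsonicSet_of_le ha hρ.1.le
  have h1 : HasDerivAt (fun ρ : ℝ => 2 * ρ ^ 2) (4 * ρ) ρ := by
    refine ((hasDerivAt_pow 2 ρ).const_mul 2).congr_deriv ?_
    push_cast
    ring
  have h2 := h1.mul
    (((fl.hasDerivAt_enthalpy hs.1).const_sub (fl.dp fl.rho0 / 2)).sub_const (fl.g * X))
  have hne : ρ ≠ 0 := hs.1.ne'
  have hd : deriv (fl.momentum X) ρ =
      4 * ρ * (fl.dp fl.rho0 / 2 - (fl.dp ρ / 2 + fl.enthalpy ρ + fl.g * X)) := by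
    refine (h2.congr_deriv ?_).deriv
    field_simp
    ring
  rw [hd]
  exact mul_neg_of_pos_of_neg (by linarith [hs.1]) (by linarith [hs.2])

lemma density_eq {T X ρ : ℝ} (h : fl.IsSubsonicDensity T X ρ) : fl.density T X = ρ := by
  have hex : ∃ ρ, fl.IsSubsonicDensity T X ρ := ⟨ρ, h⟩
  have hd : fl.density T X = hex.choose := dif_pos hex
  have h' := isSubsonicDensity_iff.1 hex.choose_spec
  have h := isSubsonicDensity_iff.1 h
  rw [hd]
  exact (momentum_strictAntiOn X).injOn h'.1 h.1 (h'.2.trans h.2.symm)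

lemma density_eq_zero {T X : ℝ} (h : ¬ ∃ ρ, fl.IsSubsonicDensity T X ρ) :
    fl.density T X = 0 := dif_neg h

lemma isSubsonicDensity_density {T X : ℝ} (h : 0 < fl.density T X) :
    fl.IsSubsonicDensity T X (fl.density T X) := by
  by_cases hex : ∃ ρ, fl.IsSubsonicDensity T X ρ
  · obtain ⟨ρ, hρ⟩ := hex
    rwa [density_eq hρ]
  · exact absurd (density_eq_zero hex) h.ne'

lemma density_nonneg (T X : ℝ) : 0 ≤ fl.density T X := by
  by_cases hex : ∃ ρ, fl.IsSubsonicDensity T X ρ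
  · obtain ⟨ρ, hρ⟩ := hex
    exact (density_eq hρ).symm ▸ hρ.1.le
  · exact (density_eq_zero hex).ge

lemma criticalDensity_nonneg (X : ℝ) : 0 ≤ fl.criticalDensity X := by
  unfold criticalDensity
  split_ifs with h
  · exact h.choose_spec.1.le
  · exact le_rfl

/-- The set of momenta with a subsonic density may be bounded below by a positive number; there the
density has the value `0`, and so has its inverse. Hence the inverse density is monotone all the way
up to any momentum that has a subsonic density. -/
lemma monotoneOn_inv_density {T₀ X : ℝ} (h₀ : 0 < fl.density T₀ X) :
    MonotoneOn (fun T => 1 / fl.density T X) (Iic T₀) := by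
  intro T₁ _ T₂ h₂ h₁₂
  rcases (density_nonneg (fl := fl) T₁ X).eq_or_lt' with hz | hpos
  · simpa [hz] using density_nonneg (fl := fl) T₂ X
  have hs₁ := isSubsonicDensity_iff.1 (isSubsonicDensity_density hpos)
  have hs₀ := isSubsonicDensity_iff.1 (isSubsonicDensity_density h₀)
  have hle : fl.density T₀ X ≤ fl.density T₁ X := by
    rw [← (momentum_strictAntiOn X).le_iff_ge hs₁.1 hs₀.1, hs₀.2, hs₁.2]
    exact h₁₂.trans h₂
  -- By the intermediate value theorem, `T₂` has a subsonic density, too.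
  have hivt := intermediate_value_Icc' hle
    ((continuousOn_momentum (fl := fl) X).mono fun s hs => h₀.trans_le hs.1)
  rw [hs₀.2, hs₁.2] at hivt
  obtain ⟨ρ, hρ, hρT⟩ := hivt ⟨h₁₂, h₂⟩
  have hρs : fl.IsSubsonicDensity T₂ X ρ :=
    isSubsonicDensity_iff.2 ⟨mem_subsonicSet_of_le hs₀.1 hρ.1, hρT⟩
  simp only [density_eq hρs]
  exact one_div_le_one_div_of_le hρs.1 hρ.2

lemma measurable_density : Measurable fun q : ℝ × ℝ => fl.density q.1 q.2 := by
  refine measurable_of_Ioi fun c => ?_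
  rcases lt_or_ge c 0 with hc | hc
  · convert MeasurableSet.univ
    exact eq_univ_of_forall fun q => hc.trans_le (density_nonneg q.1 q.2)
  -- The superlevel set is an injective continuous image of an open set.
  have hpos : ContinuousOn (fun q : ℝ × ℝ => fl.dp q.1 / 2 + fl.enthalpy q.1 + fl.g * q.2)
      (Ioi c ×ˢ univ) := by
    have hm : MapsTo (Prod.fst : ℝ × ℝ → ℝ) (Ioi c ×ˢ univ) (Ioi 0) :=
      fun q hq => hc.trans_lt hq.1
    exact (((fl.continuousOn_dp.comp continuousOn_fst hm).div_const 2).add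
      (fl.continuousOn_enthalpy.comp continuousOn_fst hm)).add (by fun_prop)
  have hopen : IsOpen {q : ℝ × ℝ | c < q.1 ∧ q.1 ∈ fl.subsonicSet q.2} := by
    convert hpos.isOpen_inter_preimage (isOpen_Ioi.prod isOpen_univ)
      (isOpen_Ioi (a := fl.dp fl.rho0 / 2)) using 1
    ext q
    simp only [mem_ofPred_eq, subsonicSet, mem_inter_iff, mem_prod, mem_Ioi, mem_univ, and_true,
      mem_preimage]
    exact ⟨fun h => ⟨h.1, h.2.2⟩, fun h => ⟨h.1, hc.trans_lt h.1, h.2⟩⟩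
  have himage : (fun q : ℝ × ℝ => fl.density q.1 q.2) ⁻¹' Ioi c =
      (fun q : ℝ × ℝ => (fl.momentum q.2 q.1, q.2)) ''
        {q : ℝ × ℝ | c < q.1 ∧ q.1 ∈ fl.subsonicSet q.2} := by
    ext q
    constructor
    · intro hq
      have hs := isSubsonicDensity_iff.1 (isSubsonicDensity_density (hc.trans_lt hq))
      exact ⟨(fl.density q.1 q.2, q.2), ⟨hq, hs.1⟩, Prod.ext hs.2 rfl⟩
    · rintro ⟨w, ⟨hw, hs⟩, rfl⟩
      have := density_eq (isSubsonicDensity_iff.2 ⟨hs, rfl⟩)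
      simpa [this] using hw
  rw [himage]
  refine hopen.measurableSet.image_of_continuousOn_injOn ?_ ?_
  · have hm : MapsTo (Prod.fst : ℝ × ℝ → ℝ) {q : ℝ × ℝ | c < q.1 ∧ q.1 ∈ fl.subsonicSet q.2}
        (Ioi 0) := fun q hq => hc.trans_lt hq.1
    refine ContinuousOn.prodMk ?_ continuousOn_snd
    exact (by fun_prop : ContinuousOn (fun q : ℝ × ℝ => 2 * q.1 ^ 2) _).mul
      ((continuousOn_const.sub (fl.continuousOn_enthalpy.comp continuousOn_fst hm)).sub
        (by fun_prop))
  · rintro ⟨ρ, X⟩ hq ⟨ρ', X'⟩ hq' heq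
    simp only [Prod.mk.injEq] at heq
    obtain ⟨h1, rfl⟩ := heq
    exact Prod.ext ((momentum_strictAntiOn X).injOn hq.2 hq'.2 h1) rfl

/-! ### The functions `F` and `λ` near the free surface condition -/

lemma monotoneOn_inv_H {t s : ℝ} (h : 0 < fl.H t s) :
    MonotoneOn (fun τ => 1 / fl.H τ s) (Iic t) := by
  have hc : 0 < 2 * fl.rho0 ^ 2 * fl.g := by have := fl.rho0_pos; have := fl.g_pos; positivity
  intro a ha b hb hab
  exact monotoneOn_inv_density h (mul_le_mul_of_nonneg_left ha hc.le)
    (mul_le_mul_of_nonneg_left hb hc.le) (mul_le_mul_of_nonneg_left hab hc.le)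

/-- The density on the free surface, where `t = s`, is `rho0`. -/
lemma H_self {s : ℝ} (hs : s < fl.stagnationHeight) : fl.H s s = fl.rho0 := by
  have hg := fl.g_pos
  have hst : fl.g * fl.stagnationHeight = fl.dp fl.rho0 / 2 := by
    unfold stagnationHeight
    field_simp
  refine density_eq ⟨fl.rho0_pos, ?_, ?_⟩
  · rw [enthalpy_rho0, mul_sub fl.g, hst]
    ring
  · rw [enthalpy_rho0, mul_sub, hst]
    have : fl.g * s < fl.dp fl.rho0 / 2 := hst ▸ mul_lt_mul_of_pos_left hs hg
    linarith

lemma intervalIntegrable_inv_H {a b t s : ℝ} (h : 0 < fl.H t s) (ha : a ≤ t) (hb : b ≤ t) :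
    IntervalIntegrable (fun τ => 1 / fl.H τ s) volume a b :=
  ((monotoneOn_inv_H h).mono fun _ hτ => hτ.2.trans (max_le ha hb)).intervalIntegrable

lemma H_nonneg (t s : ℝ) : 0 ≤ fl.H t s := density_nonneg _ _

/-- In the fluid, `F + λ` is close to `2 s / rho0` when `t` is close to `s`. -/
lemma abs_F_add_lam_sub_le {m s t : ℝ} (hm : 0 < m) (hs0 : 0 ≤ s)
    (hs : s < fl.stagnationHeight) (hm0 : m ≤ fl.rho0) (hmt : m ≤ fl.H t s) :
    |fl.F t s + fl.lam s - 2 * s / fl.rho0| ≤ 1 / m * |t - s| := by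
  have hHs : 0 < fl.H s s := by rw [H_self hs]; exact fl.rho0_pos
  have hHt : 0 < fl.H t s := hm.trans_le hmt
  -- Up to the larger of `s` and `t`, the inverse density is monotone and at most `1 / m`.
  obtain ⟨w, hsw, htw, hmw⟩ : ∃ w, s ≤ w ∧ t ≤ w ∧ m ≤ fl.H w s := by
    rcases le_total s t with h | h
    · exact ⟨t, h, le_rfl, hmt⟩
    · exact ⟨s, le_rfl, h, by rwa [H_self hs]⟩
  have hHw : 0 < fl.H w s := hm.trans_le hmw
  have hw : 0 ≤ w := hs0.trans hsw
  have hdiff : fl.F t s - fl.F s s = ∫ τ in s..t, 1 / fl.H τ s :=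
    intervalIntegral.integral_interval_sub_left (intervalIntegrable_inv_H hHw hw htw)
      (intervalIntegrable_inv_H hHw hw hsw)
  have hrw : fl.F t s + fl.lam s - 2 * s / fl.rho0 = fl.F t s - fl.F s s := by
    unfold lam Phi F₁
    rw [H_self hs]
    ring
  rw [hrw, hdiff, ← Real.norm_eq_abs]
  refine intervalIntegral.norm_integral_le_of_norm_le_const fun τ hτ => ?_
  have hτw : τ ≤ w := hτ.2.trans (max_le hsw htw)
  rw [Real.norm_of_nonneg (one_div_nonneg.2 (H_nonneg _ _))]
  exact (monotoneOn_inv_H hHw hτw self_mem_Iic hτw).trans (one_div_le_one_div_of_le hm hmw)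

lemma measurable_inv_H : Measurable fun q : ℝ × ℝ => 1 / fl.H q.1 q.2 :=
  measurable_const.div (measurable_density.comp
    ((measurable_fst.const_mul _).prodMk (measurable_snd.const_sub _)))

lemma measurable_F : Measurable fun q : ℝ × ℝ => fl.F q.1 q.2 := by
  have hmain : ∀ P : Set (ℝ × ℝ), MeasurableSet P →
      Measurable fun q : ℝ × ℝ => ∫ τ, P.indicator (fun _ => 1 / fl.H τ q.2) (q.1, τ) := by
    intro P hP
    refine (StronglyMeasurable.integral_prod_right (ν := volume) (f := fun (q : ℝ × ℝ) (τ : ℝ) =>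
      P.indicator (fun _ => 1 / fl.H τ q.2) (q.1, τ)) ?_).measurable
    refine Measurable.stronglyMeasurable ?_
    have h1 : Measurable fun w : (ℝ × ℝ) × ℝ => 1 / fl.H w.2 w.1.2 :=
      measurable_inv_H.comp (measurable_snd.prodMk (measurable_snd.comp measurable_fst))
    have h2 : Measurable fun w : (ℝ × ℝ) × ℝ => (w.1.1, w.2) := by fun_prop
    exact h1.indicator (h2 hP)
  have heq : ∀ q : ℝ × ℝ, fl.F q.1 q.2 =
      (∫ τ, {w : ℝ × ℝ | 0 < w.2 ∧ w.2 ≤ w.1}.indicator (fun _ => 1 / fl.H τ q.2) (q.1, τ)) -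
      ∫ τ, {w : ℝ × ℝ | w.1 < w.2 ∧ w.2 ≤ 0}.indicator (fun _ => 1 / fl.H τ q.2) (q.1, τ) := by
    intro q
    unfold F intervalIntegral
    rw [← integral_indicator measurableSet_Ioc, ← integral_indicator measurableSet_Ioc]
    rfl
  simp_rw [heq]
  exact (hmain _ ((measurableSet_lt measurable_const measurable_snd).inter
      (measurableSet_le measurable_snd measurable_fst))).sub
    (hmain _ ((measurableSet_lt measurable_fst measurable_snd).inter
      (measurableSet_le measurable_snd measurable_const)))

end Fluid

/-! ### One-dimensional comparison -/

/-- A function that starts positive and does not decrease where it is positive stays above its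
initial value. -/
lemma le_of_deriv_nonneg_where_pos {g : ℝ → ℝ} {S : ℝ} (hS : 0 ≤ S)
    (hc : ContinuousOn g (Icc 0 S)) (h0 : 0 < g 0)
    (hd : ∀ s ∈ Ioo 0 S, 0 < g s → ∃ d, 0 ≤ d ∧ HasDerivAt g d s) : g 0 ≤ g S := by
  have hmono : ∀ b ∈ Icc 0 S, (∀ s ∈ Ioo 0 b, 0 < g s) → g 0 ≤ g b := by
    intro b hb hpos
    have hd' : ∀ s ∈ Ioo 0 b, ∃ d, 0 ≤ d ∧ HasDerivAt g d s := fun s hs =>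
      hd s ⟨hs.1, hs.2.trans_le hb.2⟩ (hpos s hs)
    refine monotoneOn_of_deriv_nonneg (convex_Icc 0 b) (hc.mono (Icc_subset_Icc_right hb.2))
      ?_ ?_ (left_mem_Icc.2 hb.1) (right_mem_Icc.2 hb.1) hb.1
    · rw [interior_Icc]
      intro s hs
      obtain ⟨d, -, h⟩ := hd' s hs
      exact h.differentiableAt.differentiableWithinAt
    · rw [interior_Icc]
      intro s hs
      obtain ⟨d, hd0, h⟩ := hd' s hs
      rwa [h.deriv]
  refine hmono S (right_mem_Icc.2 hS) fun s hs => ?_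
  by_contra hneg
  have hcomp : IsCompact (Icc 0 S ∩ g ⁻¹' Iic 0) :=
    isCompact_Icc.of_isClosed_subset (hc.preimage_isClosed_of_isClosed isClosed_Icc isClosed_Iic)
      inter_subset_left
  -- At the first zero `b`, the function would still be at least `g 0 > 0`.
  obtain ⟨b, ⟨hb, hgb⟩, hleast⟩ :=
    hcomp.exists_isLeast ⟨s, ⟨hs.1.le, hs.2.le⟩, not_lt.1 hneg⟩
  refine absurd (hmono b hb fun τ hτ => ?_) (not_le.2 ((show g b ≤ 0 from hgb).trans_lt h0))
  by_contra hτ0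
  exact absurd (hleast ⟨⟨hτ.1.le, hτ.2.le.trans hb.2⟩, not_lt.1 hτ0⟩) (not_le.2 hτ.2)

/-- A function that starts nonpositive and does not increase where it is positive stays
nonpositive. -/
lemma nonpos_of_deriv_nonpos_where_pos {f : ℝ → ℝ} {S : ℝ} (hS : 0 ≤ S)
    (hc : ContinuousOn f (Icc 0 S)) (h0 : f 0 ≤ 0)
    (hd : ∀ s ∈ Ioo 0 S, 0 < f s → ∃ d, d ≤ 0 ∧ HasDerivAt f d s) : f S ≤ 0 := by
  by_contra! hpos
  have h := le_of_deriv_nonneg_where_pos (g := fun s => f (S - s)) hS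
    (hc.comp (by fun_prop) fun s hs => ⟨by linarith [hs.2], by linarith [hs.1]⟩)
    (by simpa using hpos) fun s hs hfs => by
      obtain ⟨d, hd0, hder⟩ := hd (S - s) ⟨by linarith [hs.2], by linarith [hs.1]⟩ hfs
      exact ⟨-d, by linarith, by simpa using hder.comp_const_sub S s⟩
  simp only [sub_zero, sub_self] at h
  linarith

/-! ### The plane, the fluid phase and the gradient -/

lemma dist_sq_eq (x y : Plane) : dist x y ^ 2 = (x 0 - y 0) ^ 2 + (x 1 - y 1) ^ 2 := by
  rw [EuclideanSpace.dist_eq, Real.sq_sqrt (by positivity), Fin.sum_univ_two, Real.dist_eq,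
    Real.dist_eq, sq_abs, sq_abs]

lemma abs_coord_sub_le (x y : Plane) (i : Fin 2) : |x i - y i| ≤ dist x y := by
  have h := dist_sq_eq x y
  refine abs_le_of_sq_le_sq ?_ dist_nonneg
  fin_cases i <;> simp <;> nlinarith [sq_nonneg (x 0 - y 0), sq_nonneg (x 1 - y 1)]

section Domain

variable {Ω : Set Plane} {u : Plane → ℝ} {x₀ : Plane}

lemma exists_ball_inter_subset (hΩ : IsHalfPlaneDomain Ω) (hx : x₀ ∈ Ω) :
    ∃ R > 0, Metric.ball x₀ R ∩ {x | 0 ≤ x 0} ⊆ Ω := by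
  obtain ⟨-, O, hO, rfl⟩ := hΩ
  obtain ⟨R, hR, hsub⟩ := Metric.isOpen_iff.1 hO x₀ hx.1
  exact ⟨R, hR, fun x hx => ⟨hsub hx.1, hx.2⟩⟩

variable {fl : Fluid}

lemma IsVariationalSolution.pos_of_mem_posSet (hΩ : IsHalfPlaneDomain Ω)
    (hu : IsVariationalSolution fl Ω u) {x : Plane} (hx : x ∈ posSet Ω u) : 0 < x 0 := by
  have h0 : 0 ≤ x 0 := by
    obtain ⟨-, O, -, rfl⟩ := hΩ
    exact hx.1.2
  exact h0.lt_of_ne fun h => hx.2.ne' (hu.zero_on_axis x hx.1 h.symm)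

lemma IsVariationalSolution.isOpen_posSet (hΩ : IsHalfPlaneDomain Ω)
    (hu : IsVariationalSolution fl Ω u) : IsOpen (posSet Ω u) := by
  have hpos : ∀ x ∈ posSet Ω u, 0 < x 0 := fun x hx => hu.pos_of_mem_posSet hΩ hx
  obtain ⟨-, O, hO, hOΩ⟩ := hΩ
  have hopen : IsOpen (O ∩ {x : Plane | 0 < x 0}) :=
    hO.inter (isOpen_lt continuous_const (by fun_prop))
  have hsub : O ∩ {x : Plane | 0 < x 0} ⊆ Ω :=
    hOΩ.symm ▸ inter_subset_inter_right O fun x (hx : 0 < x 0) => hx.le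
  convert (hu.continuousOn.mono hsub).isOpen_inter_preimage hopen
    (isOpen_Ioi (a := (0 : ℝ))) using 1
  ext x
  constructor
  · intro hx
    exact ⟨⟨(hOΩ ▸ hx.1 : x ∈ O ∩ _).1, hpos x hx⟩, hx.2⟩
  · intro hx
    exact ⟨hsub hx.1, hx.2⟩

lemma IsVariationalSolution.hasDerivAt_line (hΩ : IsHalfPlaneDomain Ω)
    (hu : IsVariationalSolution fl Ω u) {y d : Plane} {s : ℝ} (hs : y + s • d ∈ posSet Ω u) :
    HasDerivAt (fun s : ℝ => u (y + s • d))
      (gradient u (y + s • d) 0 * d 0 + gradient u (y + s • d) 1 * d 1) s := by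
  have hdiff : DifferentiableAt ℝ u (y + s • d) :=
    ((hu.contDiffOn.differentiableOn (by norm_num)) _ hs).differentiableAt
      ((hu.isOpen_posSet hΩ).mem_nhds hs)
  have h1 : HasDerivAt (fun s : ℝ => y + s • d) d s := by
    simpa using ((hasDerivAt_id s).smul_const d).const_add y
  refine (hdiff.hasFDerivAt.comp_hasDerivAt s h1).congr_deriv ?_
  have h2 : fderiv ℝ u (y + s • d) d = inner ℝ (gradient u (y + s • d)) d := by
    rw [gradient, InnerProductSpace.toDual_symm_apply]
  rw [h2, EuclideanSpace.inner_eq_star_dotProduct]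
  simp [dotProduct, Fin.sum_univ_two]
  ring

lemma norm_gradient_sq (x : Plane) :
    ‖gradient u x‖ ^ 2 = gradient u x 0 ^ 2 + gradient u x 1 ^ 2 := by
  rw [EuclideanSpace.norm_sq_eq, Fin.sum_univ_two, Real.norm_eq_abs, Real.norm_eq_abs, sq_abs,
    sq_abs]

lemma momSq_eq {x : Plane} (hx : x ∈ posSet Ω u) :
    momSq Ω u x = (1 / x 0 * gradient u x 0) ^ 2 + (1 / x 0 * gradient u x 1) ^ 2 := by
  rw [momSq, grad, indicator_of_mem hx, norm_gradient_sq]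
  ring

/-! ### The gradient at the axis point -/

/-- The growth assumption determines the limit of the axial speed up to its sign, and the sign is
`+`: otherwise `u` would decrease along horizontal lines that start at the axis, where `u = 0`. -/
lemma IsVariationalSolution.tendsto_axial_speed (hΩ : IsHalfPlaneDomain Ω)
    (hu : IsVariationalSolution fl Ω u) (hx₀ : x₀ ∈ axisPoints Ω u) (hgrowth : GrowthAt Ω u x₀) :
    Tendsto (fun x => 1 / x 0 * gradient u x 0) (𝓝[posSet Ω u] x₀) (𝓝 √(x₀ 1)) := by
  obtain ⟨⟨hxΩ, hxfr⟩, hx0, hx1⟩ := hx₀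
  obtain ⟨hlim2, l, hlim1⟩ := hu.compatibility x₀ hxΩ hx0
  have hne : (𝓝[posSet Ω u] x₀).NeBot :=
    mem_closure_iff_nhdsWithin_neBot.1 (frontier_subset_closure hxfr)
  obtain ⟨C, r, hr, hC⟩ := hgrowth
  have hball : ∀ᶠ x in 𝓝[posSet Ω u] x₀, x ∈ Metric.ball x₀ r :=
    mem_nhdsWithin_of_mem_nhds (Metric.ball_mem_nhds x₀ hr)
  have hmem : ∀ᶠ x in 𝓝[posSet Ω u] x₀, x ∈ posSet Ω u := self_mem_nhdsWithin
  have hlsq : l ^ 2 = x₀ 1 := by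
    have h1 : Tendsto (fun x : Plane => (1 / x 0 * gradient u x 0) ^ 2
        + (1 / x 0 * gradient u x 1) ^ 2 - x 1) (𝓝[posSet Ω u] x₀) (𝓝 (l ^ 2 + 0 ^ 2 - x₀ 1)) :=
      ((hlim1.pow 2).add (hlim2.pow 2)).sub
        ((by fun_prop : Continuous fun x : Plane => x 1).continuousWithinAt)
    have h2 : Tendsto (fun x : Plane => C * |x 0 - x₀ 0|) (𝓝[posSet Ω u] x₀) (𝓝 0) := by
      have : ContinuousWithinAt (fun x : Plane => C * |x 0 - x₀ 0|) (posSet Ω u) x₀ :=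
        (by fun_prop : Continuous fun x : Plane => C * |x 0 - x₀ 0|).continuousWithinAt
      simpa [ContinuousWithinAt] using this
    have h3 := squeeze_zero_norm' (f := fun x : Plane => (1 / x 0 * gradient u x 0) ^ 2
        + (1 / x 0 * gradient u x 1) ^ 2 - x 1) (by
      filter_upwards [hball, hmem] with x hxb hx
      rw [← momSq_eq hx, Real.norm_eq_abs]
      exact hC x ⟨⟨hu.pos_of_mem_posSet hΩ hx, hxb⟩, hx⟩) h2
    have := tendsto_nhds_unique h1 h3
    linarith
  have hl : 0 ≤ l := by
    by_contra! hl
    obtain ⟨R, hR, hRΩ⟩ := exists_ball_inter_subset hΩ hxΩ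
    obtain ⟨ρ, hρ, hneg⟩ := Metric.mem_nhdsWithin_iff.1 (hlim1.eventually (gt_mem_nhds hl))
    obtain ⟨y, hyball, hy⟩ := Metric.mem_closure_iff.1 (frontier_subset_closure hxfr) (min R ρ)
      (lt_min hR hρ) |>.imp fun y h => And.intro h.2 h.1
    have hy0 := hu.pos_of_mem_posSet hΩ hy
    -- The horizontal segment from the axis to `y`.
    set p : Plane := !₂[0, y 1] with hp
    set d : Plane := !₂[1, 0] with hd
    have hc0 : ∀ s : ℝ, (p + s • d) 0 = s := fun s => by simp [hp, hd]
    have hc1 : ∀ s : ℝ, (p + s • d) 1 = y 1 := fun s => by simp [hp, hd]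
    have hend : p + y 0 • d = y := by
      ext i
      fin_cases i
      · exact hc0 _
      · exact hc1 _
    have hseg : ∀ s ∈ Icc 0 (y 0), dist (p + s • d) x₀ < min R ρ := by
      intro s hs
      refine lt_of_le_of_lt ?_ (dist_comm x₀ y ▸ hyball)
      refine le_of_sq_le_sq ?_ dist_nonneg
      rw [dist_sq_eq, dist_sq_eq, hc0, hc1, hx0]
      nlinarith [hs.1, hs.2]
    have hmap : ∀ s ∈ Icc 0 (y 0), p + s • d ∈ Ω := fun s hs =>
      hRΩ ⟨(hseg s hs).trans_le (min_le_left _ _), by simp only [mem_ofPred_eq, hc0]; exact hs.1⟩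
    have hle := nonpos_of_deriv_nonpos_where_pos (f := fun s => u (p + s • d)) hy0.le
      (hu.continuousOn.comp (by fun_prop) hmap)
      (hu.zero_on_axis _ (hmap 0 ⟨le_rfl, hy0.le⟩) (hc0 0)).le fun s hs hpos => by
        have hmem : p + s • d ∈ posSet Ω u := ⟨hmap s ⟨hs.1.le, hs.2.le⟩, hpos⟩
        refine ⟨_, ?_, hu.hasDerivAt_line hΩ hmem⟩
        have h := hneg ⟨(hseg s ⟨hs.1.le, hs.2.le⟩).trans_le (min_le_right _ _), hmem⟩
        simp only [mem_ofPred_eq, hc0] at h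
        have hg : gradient u (p + s • d) 0 < 0 := by
          rw [one_div, inv_mul_eq_div] at h
          exact not_le.1 fun h0 => absurd (div_nonneg h0 hs.1.le) (not_le.2 h)
        simpa [hd] using hg.le
    rw [hend] at hle
    exact absurd hy.2 (not_lt.2 hle)
  rwa [← hlsq, Real.sqrt_sq hl]

/-- In the fluid near the axis point, `∇u` is close to `√x₂° x₁ e₁`, relative to `x₁`. -/
lemma IsVariationalSolution.gradient_near_axisPoint (hΩ : IsHalfPlaneDomain Ω)
    (hu : IsVariationalSolution fl Ω u) (hx₀ : x₀ ∈ axisPoints Ω u) (hgrowth : GrowthAt Ω u x₀)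
    {ε : ℝ} (hε : 0 < ε) :
    ∃ R > 0, Metric.ball x₀ R ∩ {x | 0 ≤ x 0} ⊆ Ω ∧ ∀ x ∈ Metric.ball x₀ R ∩ posSet Ω u,
      |gradient u x 0 - √(x₀ 1) * x 0| ≤ ε * x 0 ∧ |gradient u x 1| ≤ ε * x 0 := by
  have h0 := hu.tendsto_axial_speed hΩ hx₀ hgrowth
  have h1 := (hu.compatibility x₀ hx₀.1.1 hx₀.2.1).1
  obtain ⟨R₁, hR₁, hΩ₁⟩ := exists_ball_inter_subset hΩ hx₀.1.1
  obtain ⟨R₂, hR₂, h₂⟩ := Metric.mem_nhdsWithin_iff.1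
    ((h0.eventually (Metric.closedBall_mem_nhds _ hε)).and
      (h1.eventually (Metric.closedBall_mem_nhds _ hε)))
  refine ⟨min R₁ R₂, lt_min hR₁ hR₂, fun x hx =>
    hΩ₁ ⟨Metric.ball_subset_ball (min_le_left _ _) hx.1, hx.2⟩, fun x hx => ?_⟩
  have hpos := hu.pos_of_mem_posSet hΩ hx.2
  obtain ⟨ha, hb⟩ := h₂ ⟨Metric.ball_subset_ball (min_le_right _ _) hx.1, hx.2⟩
  change dist _ _ ≤ ε at ha hb
  rw [Real.dist_eq] at ha hb
  constructor
  · rw [show gradient u x 0 - √(x₀ 1) * x 0 = (1 / x 0 * gradient u x 0 - √(x₀ 1)) * x 0 by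
      field_simp, abs_mul, abs_of_pos hpos]
    exact mul_le_mul_of_nonneg_right ha hpos.le
  · rw [show gradient u x 1 = (1 / x 0 * gradient u x 1 - 0) * x 0 by field_simp; ring,
      abs_mul, abs_of_pos hpos]
    exact mul_le_mul_of_nonneg_right hb hpos.le

/-! ### Cone monotonicity of the fluid phase -/

/-- Near the axis point, `u` increases along all directions of an arbitrarily wide cone around `e₁`,
so that the fluid phase is stable under translation by such directions. -/
lemma IsVariationalSolution.posSet_cone (hΩ : IsHalfPlaneDomain Ω)
    (hu : IsVariationalSolution fl Ω u) (hx₀ : x₀ ∈ axisPoints Ω u) (hgrowth : GrowthAt Ω u x₀)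
    {κ : ℝ} (hκ : 0 < κ) :
    ∃ R > 0, Metric.ball x₀ R ∩ {x | 0 ≤ x 0} ⊆ Ω ∧ ∀ y ∈ Metric.ball x₀ R ∩ posSet Ω u,
      ∀ z ∈ Metric.ball x₀ R, κ * |z 1 - y 1| ≤ z 0 - y 0 → z ∈ posSet Ω u := by
  set l := √(x₀ 1) with hl_def
  have hl : 0 < l := Real.sqrt_pos.2 hx₀.2.2
  -- `ε` solves `ε = κ (l - ε)`.
  set ε := κ * l / (1 + κ) with hε_def
  have hε : 0 < ε := by positivity
  have hεκ : ε = κ * (l - ε) := by rw [hε_def]; field_simp; ring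
  have hlε : 0 < l - ε := by
    by_contra! h
    nlinarith
  obtain ⟨R, hR, hRΩ, hgrad⟩ := hu.gradient_near_axisPoint hΩ hx₀ hgrowth hε
  refine ⟨R, hR, hRΩ, fun y hy z hz hzy => ?_⟩
  have hy0 := hu.pos_of_mem_posSet hΩ hy.2
  have hd0 : 0 ≤ z 0 - y 0 := (by positivity : 0 ≤ κ * |z 1 - y 1|).trans hzy
  have hcoord : ∀ s : ℝ, (y + s • (z - y)) 0 = y 0 + s * (z 0 - y 0) := fun s => by simp
  have hball : ∀ s ∈ Icc (0 : ℝ) 1, y + s • (z - y) ∈ Metric.ball x₀ R := fun s hs =>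
    (convex_ball x₀ R).add_smul_sub_mem hy.1 hz hs
  have hmap : ∀ s ∈ Icc (0 : ℝ) 1, y + s • (z - y) ∈ Ω := fun s hs => by
    refine hRΩ ⟨hball s hs, ?_⟩
    rw [mem_ofPred_eq, hcoord]
    have := mul_nonneg hs.1 hd0
    linarith
  have hle := le_of_deriv_nonneg_where_pos (g := fun s : ℝ => u (y + s • (z - y))) zero_le_one
    (hu.continuousOn.comp (by fun_prop) hmap) (by simpa using hy.2.2) fun s hs hpos => by
      have hs' : s ∈ Icc (0 : ℝ) 1 := ⟨hs.1.le, hs.2.le⟩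
      have hmem : y + s • (z - y) ∈ posSet Ω u := ⟨hmap s hs', hpos⟩
      refine ⟨_, ?_, hu.hasDerivAt_line hΩ hmem⟩
      obtain ⟨ha, hb⟩ := hgrad _ ⟨hball s hs', hmem⟩
      have hx := hu.pos_of_mem_posSet hΩ hmem
      generalize y + s • (z - y) = x at ha hb hx
      have h1 : (l - ε) * x 0 ≤ gradient u x 0 := by linarith [(abs_le.1 ha).1]
      have h2 : |gradient u x 1 * (z 1 - y 1)| ≤ ε * x 0 * |z 1 - y 1| := by
        rw [abs_mul]
        exact mul_le_mul_of_nonneg_right hb (abs_nonneg _)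
      have h3 : ε * x 0 * |z 1 - y 1| ≤ (l - ε) * x 0 * (z 0 - y 0) := by
        calc ε * x 0 * |z 1 - y 1| = (l - ε) * x 0 * (κ * |z 1 - y 1|) := by
              linear_combination (x 0 * |z 1 - y 1|) * hεκ
          _ ≤ _ := mul_le_mul_of_nonneg_left hzy (by positivity)
      have h4 := mul_le_mul_of_nonneg_right h1 hd0
      have h5 := (abs_le.1 h2).1
      simp only [PiLp.sub_apply]
      linarith
  simp only [zero_smul, add_zero, one_smul, add_sub_cancel] at hle
  have hzΩ := hmap 1 ⟨zero_le_one, le_rfl⟩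
  rw [one_smul, add_sub_cancel] at hzΩ
  exact ⟨hzΩ, hy.2.2.trans_le hle⟩

/-- Near the axis point, translating a point of the closure of the fluid phase, such as a free
boundary point, by a vector of a wide open cone around `e₁` leads into the fluid phase. -/
lemma IsVariationalSolution.closure_posSet_cone (hΩ : IsHalfPlaneDomain Ω)
    (hu : IsVariationalSolution fl Ω u) (hx₀ : x₀ ∈ axisPoints Ω u) (hgrowth : GrowthAt Ω u x₀)
    {κ : ℝ} (hκ : 0 < κ) :
    ∃ R > 0, Metric.ball x₀ R ∩ {x | 0 ≤ x 0} ⊆ Ω ∧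
      ∀ y ∈ Metric.ball x₀ R ∩ closure (posSet Ω u),
      ∀ z ∈ Metric.ball x₀ R, κ * |z 1 - y 1| < z 0 - y 0 → z ∈ posSet Ω u := by
  obtain ⟨R, hR, hRΩ, hcone⟩ := hu.posSet_cone hΩ hx₀ hgrowth hκ
  refine ⟨R, hR, hRΩ, fun y hy z hz hzy => ?_⟩
  have hopen : IsOpen {w : Plane | κ * |z 1 - w 1| < z 0 - w 0} :=
    isOpen_lt (by fun_prop) (by fun_prop)
  obtain ⟨w, hw, hwpos⟩ := mem_closure_iff.1 hy.2 _ (hopen.inter Metric.isOpen_ball) ⟨hzy, hy.1⟩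
  exact hcone w ⟨hw.2, hwpos⟩ z hz (le_of_lt hw.1)

/-- Near the axis point, the fluid phase contains the wide cone with vertex `x°` around `e₁`. -/
lemma IsVariationalSolution.mem_posSet_of_mem_cone (hΩ : IsHalfPlaneDomain Ω)
    (hu : IsVariationalSolution fl Ω u) (hx₀ : x₀ ∈ axisPoints Ω u) (hgrowth : GrowthAt Ω u x₀)
    {κ : ℝ} (hκ : 0 < κ) :
    ∃ R > 0, ∀ z ∈ Metric.ball x₀ R, κ * |z 1 - x₀ 1| < z 0 → z ∈ posSet Ω u := by
  obtain ⟨R, hR, -, hcone⟩ := hu.closure_posSet_cone hΩ hx₀ hgrowth hκ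
  refine ⟨R, hR, fun z hz hzx => hcone x₀ ⟨Metric.mem_ball_self hR,
    frontier_subset_closure hx₀.1.2⟩ z hz ?_⟩
  rwa [hx₀.2.1, sub_zero]

/-! ### The asymptotic profile -/

lemma IsVariationalSolution.hasDerivAt_horizontal (hΩ : IsHalfPlaneDomain Ω)
    (hu : IsVariationalSolution fl Ω u) {b s : ℝ} (hs : !₂[s, b] ∈ posSet Ω u) :
    HasDerivAt (fun s : ℝ => u !₂[s, b]) (gradient u !₂[s, b] 0) s := by
  have hp : ∀ s : ℝ, (!₂[s, b] : Plane) = !₂[0, b] + s • !₂[1, 0] := fun s => by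
    ext i
    fin_cases i <;> simp
  have := hu.hasDerivAt_line hΩ (y := !₂[0, b]) (d := !₂[1, 0]) (s := s) (by rwa [← hp])
  simp_rw [← hp] at this
  simpa using this

lemma eq_vec (x : Plane) : !₂[x 0, x 1] = x := by
  ext i
  fin_cases i <;> rfl

lemma dist_horizontal_le (hx0 : x₀ 0 = 0) {x : Plane} {s : ℝ} (hs : s ∈ Icc 0 (x 0)) :
    dist !₂[s, x 1] x₀ ≤ dist x x₀ := by
  refine le_of_sq_le_sq ?_ dist_nonneg
  rw [dist_sq_eq, dist_sq_eq, hx0]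
  simp only [Matrix.cons_val_zero, Matrix.cons_val_one]
  nlinarith [hs.1, hs.2]

lemma continuous_horizontal (b : ℝ) : Continuous fun s : ℝ => (!₂[s, b] : Plane) := by
  fun_prop

/-- Near the axis point, `u` is bounded above by a multiple of `x₁²` with a constant close to
`√x₂° / 2`. -/
lemma IsVariationalSolution.le_quadratic (hΩ : IsHalfPlaneDomain Ω)
    (hu : IsVariationalSolution fl Ω u) (hx₀ : x₀ ∈ axisPoints Ω u) (hgrowth : GrowthAt Ω u x₀)
    {ε : ℝ} (hε : 0 < ε) :
    ∃ R > 0, ∀ x ∈ Metric.ball x₀ R, 0 ≤ x 0 → u x ≤ (√(x₀ 1) + ε) * x 0 ^ 2 / 2 := by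
  obtain ⟨R, hR, hRΩ, hgrad⟩ := hu.gradient_near_axisPoint hΩ hx₀ hgrowth hε
  refine ⟨R, hR, fun x hx hx0 => ?_⟩
  have hball : ∀ s ∈ Icc 0 (x 0), !₂[s, x 1] ∈ Metric.ball x₀ R := fun s hs =>
    (dist_horizontal_le hx₀.2.1 hs).trans_lt hx
  have hmap : ∀ s ∈ Icc 0 (x 0), !₂[s, x 1] ∈ Ω := fun s hs => hRΩ ⟨hball s hs, hs.1⟩
  have h := nonpos_of_deriv_nonpos_where_pos
    (f := fun s : ℝ => u !₂[s, x 1] - (√(x₀ 1) + ε) * s ^ 2 / 2) hx0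
    ((hu.continuousOn.comp (continuous_horizontal _).continuousOn hmap).sub (by fun_prop))
    (by simp [hu.zero_on_axis _ (hmap 0 ⟨le_rfl, hx0⟩) rfl]) fun s hs hpos => by
      have hs' : s ∈ Icc 0 (x 0) := ⟨hs.1.le, hs.2.le⟩
      have hmem : !₂[s, x 1] ∈ posSet Ω u := by
        refine ⟨hmap s hs', lt_of_le_of_lt ?_ (sub_pos.1 hpos)⟩
        positivity
      have hq : HasDerivAt (fun s : ℝ => (√(x₀ 1) + ε) * s ^ 2 / 2) ((√(x₀ 1) + ε) * s) s := by
        refine (((hasDerivAt_pow 2 s).const_mul (√(x₀ 1) + ε)).div_const 2).congr_deriv ?_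
        push_cast
        ring
      refine ⟨_, ?_, (hu.hasDerivAt_horizontal hΩ hmem).sub hq⟩
      have hg := (abs_le.1 (hgrad _ ⟨hball s hs', hmem⟩).1).2
      have hc : (!₂[s, x 1] : Plane) 0 = s := rfl
      rw [hc] at hg
      linarith
  simp only [eq_vec] at h
  linarith

/-- The blow-up limit of `u` at the axis point is `√x₂° x₁² / 2`. -/
lemma IsVariationalSolution.abs_sub_quadratic_le (hΩ : IsHalfPlaneDomain Ω)
    (hu : IsVariationalSolution fl Ω u) (hx₀ : x₀ ∈ axisPoints Ω u) (hgrowth : GrowthAt Ω u x₀)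
    {δ : ℝ} (hδ : 0 < δ) :
    ∃ R > 0, ∀ x ∈ Metric.ball x₀ R, 0 ≤ x 0 →
      |u x - √(x₀ 1) * x 0 ^ 2 / 2| ≤ δ * dist x x₀ ^ 2 := by
  set l := √(x₀ 1) with hl_def
  have hl : 0 < l := Real.sqrt_pos.2 hx₀.2.2
  obtain ⟨κ, hκ, hκδ⟩ : ∃ κ > 0, l * κ ^ 2 ≤ δ := by
    refine ⟨√(δ / l), by positivity, ?_⟩
    rw [Real.sq_sqrt (by positivity)]
    field_simp
    exact le_rfl
  obtain ⟨R₁, hR₁, hupper⟩ := hu.le_quadratic hΩ hx₀ hgrowth hδ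
  obtain ⟨R₂, hR₂, hRΩ, hgrad⟩ := hu.gradient_near_axisPoint hΩ hx₀ hgrowth hδ
  obtain ⟨R₃, hR₃, hcone⟩ := hu.mem_posSet_of_mem_cone hΩ hx₀ hgrowth hκ
  refine ⟨min R₁ (min R₂ R₃), by positivity, fun x hx hx0 => ?_⟩
  have hx1 : x ∈ Metric.ball x₀ R₁ := Metric.ball_subset_ball (min_le_left _ _) hx
  have hx2 : x ∈ Metric.ball x₀ R₂ :=
    Metric.ball_subset_ball ((min_le_right _ _).trans (min_le_left _ _)) hx
  have hx3 : x ∈ Metric.ball x₀ R₃ :=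
    Metric.ball_subset_ball ((min_le_right _ _).trans (min_le_right _ _)) hx
  have hd0 : |x 0| ≤ dist x x₀ := by simpa [hx₀.2.1] using abs_coord_sub_le x x₀ 0
  have hd1 := abs_coord_sub_le x x₀ 1
  have hd0sq : x 0 ^ 2 ≤ dist x x₀ ^ 2 := sq_le_sq' (abs_le.1 hd0).1 (abs_le.1 hd0).2
  have hδ0 := mul_le_mul_of_nonneg_left hd0sq hδ.le
  have hδx : 0 ≤ δ * x 0 ^ 2 := by positivity
  rw [abs_le]
  refine ⟨?_, by linarith [hupper x hx1 hx0]⟩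
  -- Up to the distance `a = κ |x - x°|` from the axis, `u ≥ 0` suffices; beyond it there is only
  -- fluid, and the lower bound for `∂₁u` can be integrated.
  set a := κ * dist x x₀ with ha_def
  have ha0 : 0 ≤ a := by positivity
  have hasq : l * a ^ 2 ≤ δ * dist x x₀ ^ 2 := by
    rw [ha_def, mul_pow, ← mul_assoc]
    exact mul_le_mul_of_nonneg_right hκδ (sq_nonneg _)
  rcases le_or_gt (x 0) a with hxa | hxa
  · have hu0 := hu.nonneg x (hRΩ ⟨hx2, hx0⟩)
    have : l * x 0 ^ 2 ≤ l * a ^ 2 :=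
      mul_le_mul_of_nonneg_left (pow_le_pow_left₀ hx0 hxa 2) hl.le
    nlinarith [mul_nonneg hl.le (sq_nonneg (x 0))]
  have hsub : ∀ s ∈ Icc a (x 0), s ∈ Icc 0 (x 0) := fun s hs => ⟨ha0.trans hs.1, hs.2⟩
  have hmap : ∀ s ∈ Icc a (x 0), !₂[s, x 1] ∈ Ω := fun s hs =>
    hRΩ ⟨(dist_horizontal_le hx₀.2.1 (hsub s hs)).trans_lt hx2, (hsub s hs).1⟩
  have hder : ∀ s ∈ Ioo a (x 0), !₂[s, x 1] ∈ posSet Ω u ∧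
      HasDerivAt (fun s : ℝ => u !₂[s, x 1] - (l - δ) * s ^ 2 / 2)
        (gradient u !₂[s, x 1] 0 - (l - δ) * s) s := by
    intro s hs
    have hmem : !₂[s, x 1] ∈ posSet Ω u := by
      refine hcone _ ((dist_horizontal_le hx₀.2.1 (hsub s ⟨hs.1.le, hs.2.le⟩)).trans_lt hx3) ?_
      exact (mul_le_mul_of_nonneg_left hd1 hκ.le).trans_lt hs.1
    have hq : HasDerivAt (fun s : ℝ => (l - δ) * s ^ 2 / 2) ((l - δ) * s) s := by
      refine (((hasDerivAt_pow 2 s).const_mul (l - δ)).div_const 2).congr_deriv ?_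
      push_cast
      ring
    exact ⟨hmem, (hu.hasDerivAt_horizontal hΩ hmem).sub hq⟩
  have hmono := monotoneOn_of_deriv_nonneg (convex_Icc a (x 0))
    (f := fun s : ℝ => u !₂[s, x 1] - (l - δ) * s ^ 2 / 2)
    ((hu.continuousOn.comp (continuous_horizontal _).continuousOn hmap).sub (by fun_prop))
    (by
      rw [interior_Icc]
      exact fun s hs => (hder s hs).2.differentiableAt.differentiableWithinAt)
    (by
      rw [interior_Icc]
      intro s hs
      rw [(hder s hs).2.deriv]
      have hg := (abs_le.1 (hgrad _ ⟨(dist_horizontal_le hx₀.2.1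
        (hsub s ⟨hs.1.le, hs.2.le⟩)).trans_lt hx2, (hder s hs).1⟩).1).1
      have hc : (!₂[s, x 1] : Plane) 0 = s := rfl
      rw [hc] at hg
      linarith)
    (left_mem_Icc.2 hxa.le) (right_mem_Icc.2 hxa.le) hxa.le
  simp only [eq_vec] at hmono
  have hu0 := hu.nonneg _ (hmap a (left_mem_Icc.2 hxa.le))
  have : 0 ≤ δ * a ^ 2 := by positivity
  nlinarith

end Domain

/-! ### The Weiss energy at the axis point -/

/-- The integral of a function over the plane in polar coordinates centred at `x₀`. -/
lemma integral_polar (x₀ : Plane) (f : Plane → ℝ) :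
    ∫ x, f x = ∫ p in polarCoord.target, p.1 * f (arcPoint x₀ p.1 p.2) := by
  have hmp : MeasurePreserving (fun x : Plane => ((x 0, x 1) : ℝ × ℝ)) volume volume :=
    (volume_preserving_finTwoArrow ℝ).comp
      (EuclideanSpace.volume_preserving_symm_measurableEquiv_toLp (Fin 2))
  have hemb : MeasurableEmbedding (fun x : Plane => ((x 0, x 1) : ℝ × ℝ)) :=
    (MeasurableEquiv.finTwoArrow (α := ℝ)).measurableEmbedding.comp
      (MeasurableEquiv.toLp 2 (Fin 2 → ℝ)).symm.measurableEmbedding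
  calc ∫ x, f x = ∫ x, f (x₀ + x) := (integral_add_left_eq_self f x₀).symm
    _ = ∫ x : Plane, (fun p : ℝ × ℝ => f (x₀ + !₂[p.1, p.2])) (x 0, x 1) := by
        simp only [eq_vec]
    _ = ∫ p : ℝ × ℝ, f (x₀ + !₂[p.1, p.2]) :=
        hmp.integral_comp hemb (fun p : ℝ × ℝ => f (x₀ + !₂[p.1, p.2]))
    _ = _ := by
        rw [← integral_comp_polarCoord_symm]
        refine setIntegral_congr_fun polarCoord.open_target.measurableSet fun p _ => ?_
        simp only [polarCoord_symm_apply, smul_eq_mul]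
        congr 2
        ext i
        fin_cases i <;> simp [arcPoint]

lemma dist_arcPoint (x₀ : Plane) {r : ℝ} (hr : 0 ≤ r) (θ : ℝ) :
    dist (arcPoint x₀ r θ) x₀ = r := by
  rw [← sq_eq_sq₀ dist_nonneg hr, dist_sq_eq]
  have h0 : arcPoint x₀ r θ 0 = x₀ 0 + r * Real.cos θ := rfl
  have h1 : arcPoint x₀ r θ 1 = x₀ 1 + r * Real.sin θ := rfl
  rw [h0, h1]
  linear_combination r ^ 2 * Real.sin_sq_add_cos_sq θ

lemma arcPoint_zero {x₀ : Plane} (hx₀ : x₀ 0 = 0) (r θ : ℝ) :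
    arcPoint x₀ r θ 0 = r * Real.cos θ := by
  have h0 : arcPoint x₀ r θ 0 = x₀ 0 + r * Real.cos θ := rfl
  rw [h0, hx₀, zero_add]

lemma measurableSet_halfBall (x₀ : Plane) (r : ℝ) : MeasurableSet (halfBall x₀ r) :=
  ((isOpen_lt continuous_const (by fun_prop)).inter Metric.isOpen_ball).measurableSet

lemma integral_halfBall_fst {x₀ : Plane} (hx₀ : x₀ 0 = 0) {r : ℝ} (hr : 0 ≤ r) :
    ∫ x in halfBall x₀ r, x 0 = 2 / 3 * r ^ 3 := by
  rw [← integral_indicator (measurableSet_halfBall x₀ r), integral_polar x₀]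
  have hsub : Ioo 0 r ×ˢ Ioo (-(Real.pi / 2)) (Real.pi / 2) ⊆ polarCoord.target := by
    rintro ⟨ρ, θ⟩ ⟨hρ, hθ⟩
    have := Real.pi_pos
    exact ⟨hρ.1, by linarith [hθ.1], by linarith [hθ.2]⟩
  have hcongr : ∀ p ∈ polarCoord.target,
      p.1 * (halfBall x₀ r).indicator (fun x => x 0) (arcPoint x₀ p.1 p.2) =
        (Ioo 0 r ×ˢ Ioo (-(Real.pi / 2)) (Real.pi / 2)).indicator
          (fun p : ℝ × ℝ => p.1 ^ 2 * Real.cos p.2) p := by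
    rintro ⟨ρ, θ⟩ ⟨hρ, hθ⟩
    have hρ' : 0 < ρ := hρ
    simp only at hθ
    have hiff : arcPoint x₀ ρ θ ∈ halfBall x₀ r ↔
        (ρ, θ) ∈ Ioo 0 r ×ˢ Ioo (-(Real.pi / 2)) (Real.pi / 2) := by
      have h0 : 0 < ρ * Real.cos θ ↔ θ ∈ Ioo (-(Real.pi / 2)) (Real.pi / 2) := by
        rw [mul_pos_iff_of_pos_left hρ']
        refine ⟨fun h => ?_, Real.cos_pos_of_mem_Ioo⟩
        have hpi := Real.pi_pos
        constructor
        · by_contra! hle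
          have := Real.cos_nonpos_of_pi_div_two_le_of_le (x := -θ) (by linarith)
            (by linarith [hθ.1])
          rw [Real.cos_neg] at this
          linarith
        · by_contra! hle
          have := Real.cos_nonpos_of_pi_div_two_le_of_le hle (by linarith [hθ.2])
          linarith
      rw [halfBall, mem_inter_iff, Metric.mem_ball, dist_arcPoint x₀ hρ'.le, mem_ofPred_eq,
        arcPoint_zero hx₀, h0, mem_prod]
      exact ⟨fun h => ⟨⟨hρ', h.2⟩, h.1⟩, fun h => ⟨h.2, h.1.2⟩⟩
    by_cases h : (ρ, θ) ∈ Ioo 0 r ×ˢ Ioo (-(Real.pi / 2)) (Real.pi / 2)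
    · rw [indicator_of_mem h, indicator_of_mem (hiff.2 h), arcPoint_zero hx₀]
      ring
    · rw [indicator_of_notMem h, indicator_of_notMem (mt hiff.1 h), mul_zero]
  rw [setIntegral_congr_fun polarCoord.open_target.measurableSet hcongr,
    setIntegral_indicator (measurableSet_Ioo.prod measurableSet_Ioo), inter_eq_right.2 hsub,
    Measure.volume_eq_prod, setIntegral_prod_mul (fun ρ : ℝ => ρ ^ 2) Real.cos,
    ← integral_Ioc_eq_integral_Ioo, ← integral_Ioc_eq_integral_Ioo,
    ← intervalIntegral.integral_of_le hr,
    ← intervalIntegral.integral_of_le (by linarith [Real.pi_pos]), integral_pow, integral_cos,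
    Real.sin_neg, Real.sin_pi_div_two]
  norm_num
  ring

section Domain

variable {Ω : Set Plane} {u : Plane → ℝ} {x₀ : Plane} {fl : Fluid}

lemma IsVariationalSolution.measurable_momSq (hΩ : IsHalfPlaneDomain Ω)
    (hu : IsVariationalSolution fl Ω u) : Measurable (momSq Ω u) := by
  have hg : Measurable (gradient u) :=
    (InnerProductSpace.toDual ℝ Plane).symm.continuous.measurable.comp (measurable_fderiv ℝ u)
  have h : Measurable (grad Ω u) := hg.indicator (hu.isOpen_posSet hΩ).measurableSet
  exact (h.norm.pow_const 2).div (by fun_prop)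

lemma Fluid.measurable_lam : Measurable fl.lam := by
  have h := (measurable_F (fl := fl)).comp (measurable_id.prodMk measurable_id)
  have h' := (measurable_inv_H (fl := fl)).comp (measurable_id.prodMk measurable_id)
  exact ((measurable_id.const_mul 2).mul h').sub h

/-- The energy density `x₁ (F + λ χ)`. -/
noncomputable def energyDensity (fl : Fluid) (Ω : Set Plane) (u : Plane → ℝ) (x : Plane) : ℝ :=
  x 0 * (fl.F (momSq Ω u x) (x 1) + fl.lam (x 1) * chi Ω u x)

lemma IsVariationalSolution.measurable_energyDensity (hΩ : IsHalfPlaneDomain Ω)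
    (hu : IsVariationalSolution fl Ω u) : Measurable (energyDensity fl Ω u) := by
  have h1 : Measurable fun x : Plane => x 1 := by fun_prop
  have hF : Measurable fun x => fl.F (momSq Ω u x) (x 1) :=
    Fluid.measurable_F.comp ((hu.measurable_momSq hΩ).prodMk h1)
  have hchi : Measurable (chi Ω u) :=
    measurable_const.indicator (hu.isOpen_posSet hΩ).measurableSet
  exact (by fun_prop : Measurable fun x : Plane => x 0).mul
    (hF.add ((Fluid.measurable_lam.comp h1).mul hchi))

/-- To leading order, the energy density is that of the full half ball of fluid with `t = x₂`: in
the fluid by the growth assumption, and outside because only a thin cusp is left there. -/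
lemma IsVariationalSolution.energyDensity_near (hΩ : IsHalfPlaneDomain Ω)
    (hu : IsVariationalSolution fl Ω u) (hx₀ : x₀ ∈ axisPoints Ω u)
    (hsub : x₀ 1 < fl.stagnationHeight) (hgrowth : GrowthAt Ω u x₀) {δ : ℝ} (hδ : 0 < δ) :
    ∃ R > 0, ∀ x ∈ halfBall x₀ R,
      |energyDensity fl Ω u x - 2 * x₀ 1 / fl.rho0 * x 0| ≤ δ * dist x x₀ := by
  have hρ := fl.rho0_pos
  have hx₀1 : 0 < x₀ 1 := hx₀.2.2
  set c := 2 * x₀ 1 / fl.rho0 with hc_def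
  have hc : 0 < c := by positivity
  obtain ⟨R₁, hR₁, hcone⟩ := hu.mem_posSet_of_mem_cone hΩ hx₀ hgrowth (div_pos hδ hc)
  obtain ⟨R₂, hR₂, hRΩ⟩ := exists_ball_inter_subset hΩ hx₀.1.1
  obtain ⟨ε, hε, hHε⟩ := hu.subsonic (Metric.closedBall x₀ (R₂ / 2) ∩ {x | 0 ≤ x 0})
    ((isCompact_closedBall x₀ _).inter_right (isClosed_le continuous_const (by fun_prop)))
    fun x hx => hRΩ ⟨Metric.closedBall_subset_ball (by linarith) hx.1, hx.2⟩
  obtain ⟨C, R₃, hR₃, hC⟩ := hgrowth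
  set m := min ε fl.rho0 with hm_def
  have hm : 0 < m := lt_min hε hρ
  set D := 1 / m * |C| + 2 / fl.rho0 with hD_def
  have hD : 0 < D := by positivity
  refine ⟨min (min R₁ (R₂ / 2)) (min R₃ (min (min (x₀ 1) (fl.stagnationHeight - x₀ 1)) (δ / D))),
    by have := sub_pos.2 hsub; positivity, fun x hx => ?_⟩
  have hx0 : 0 < x 0 := hx.1
  have hdist : dist x x₀ < min (min R₁ (R₂ / 2)) (min R₃ (min (min (x₀ 1)
    (fl.stagnationHeight - x₀ 1)) (δ / D))) := hx.2
  simp only [lt_min_iff] at hdist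
  obtain ⟨⟨hd1, hd2⟩, hd3, ⟨hd4, hd5⟩, hd6⟩ := hdist
  have hco0 : x 0 ≤ dist x x₀ := by
    simpa [hx₀.2.1, abs_of_pos hx0] using abs_coord_sub_le x x₀ 0
  have hco1 := abs_coord_sub_le x x₀ 1
  by_cases hpos : x ∈ posSet Ω u
  · have hH : m ≤ fl.H (momSq Ω u x) (x 1) := by
      have h1 := hHε x ⟨⟨hd2.le, hx0.le⟩, hpos⟩
      have h2 := fl.criticalDensity_nonneg (fl.stagnationHeight - x 1)
      exact (min_le_left _ _).trans (by linarith)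
    have hF := Fluid.abs_F_add_lam_sub_le hm (s := x 1) (by linarith [(abs_le.1 hco1).1])
      (by linarith [(abs_le.1 hco1).2]) (min_le_right _ _) hH
    have hg : |momSq Ω u x - x 1| ≤ |C| * x 0 := by
      have := hC x ⟨⟨hx0, hd3⟩, hpos⟩
      rw [hx₀.2.1, sub_zero, abs_of_pos hx0] at this
      exact this.trans (mul_le_mul_of_nonneg_right (le_abs_self C) hx0.le)
    have hchi : chi Ω u x = 1 := indicator_of_mem hpos _
    have hval : energyDensity fl Ω u x - c * x 0 = x 0 * ((fl.F (momSq Ω u x) (x 1) + fl.lam (x 1)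
        - 2 * x 1 / fl.rho0) + 2 / fl.rho0 * (x 1 - x₀ 1)) := by
      rw [energyDensity, hchi, hc_def]
      ring
    have hbound : |(fl.F (momSq Ω u x) (x 1) + fl.lam (x 1) - 2 * x 1 / fl.rho0)
        + 2 / fl.rho0 * (x 1 - x₀ 1)| ≤ D * dist x x₀ := by
      refine (abs_add_le _ _).trans ?_
      rw [hD_def, add_mul]
      refine add_le_add (hF.trans ?_) ?_
      · rw [mul_assoc]
        exact mul_le_mul_of_nonneg_left
          (hg.trans (mul_le_mul_of_nonneg_left hco0 (abs_nonneg C))) (by positivity)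
      · rw [abs_mul, abs_of_pos (by positivity : 0 < 2 / fl.rho0)]
        exact mul_le_mul_of_nonneg_left hco1 (by positivity)
    rw [hval, abs_mul, abs_of_pos hx0, mul_comm]
    refine mul_le_mul (hbound.trans ?_) hco0 hx0.le hδ.le
    rw [lt_div_iff₀ hD] at hd6
    linarith
  · have hchi : chi Ω u x = 0 := indicator_of_notMem hpos _
    have hmom : momSq Ω u x = 0 := by
      rw [momSq, grad, indicator_of_notMem hpos]
      simp
    have hval : energyDensity fl Ω u x = 0 := by
      rw [energyDensity, hchi, hmom, Fluid.F, intervalIntegral.integral_same]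
      ring
    have hle : x 0 ≤ δ / c * |x 1 - x₀ 1| := by
      by_contra! h
      exact hpos (hcone x hd1 h)
    rw [hval, zero_sub, abs_neg, abs_of_pos (by positivity)]
    calc c * x 0 ≤ c * (δ / c * dist x x₀) := mul_le_mul_of_nonneg_left
          (hle.trans (mul_le_mul_of_nonneg_left hco1 (by positivity))) hc.le
      _ = δ * dist x x₀ := by field_simp

lemma volume_real_halfBall_le (x₀ : Plane) {r : ℝ} (hr : 0 ≤ r) :
    volume.real (halfBall x₀ r) ≤ Real.pi * r ^ 2 := by
  refine (measureReal_mono inter_subset_right measure_ball_lt_top.ne).trans_eq ?_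
  rw [measureReal_def, EuclideanSpace.volume_ball_fin_two, ENNReal.toReal_mul, ENNReal.toReal_pow,
    ENNReal.toReal_ofReal hr, ENNReal.toReal_ofReal Real.pi_pos.le, mul_comm]

lemma volume_halfBall_lt_top (x₀ : Plane) (r : ℝ) : volume (halfBall x₀ r) < ⊤ :=
  (measure_mono inter_subset_right).trans_lt measure_ball_lt_top

lemma IsVariationalSolution.tendsto_energyI (hΩ : IsHalfPlaneDomain Ω)
    (hu : IsVariationalSolution fl Ω u) (hx₀ : x₀ ∈ axisPoints Ω u)
    (hsub : x₀ 1 < fl.stagnationHeight) (hgrowth : GrowthAt Ω u x₀) :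
    Tendsto (fun r => energyI fl Ω u x₀ r / r ^ 3) (𝓝[>] 0)
      (𝓝 (2 * x₀ 1 / fl.rho0 * (2 / 3))) := by
  set c := 2 * x₀ 1 / fl.rho0 with hc_def
  rw [Metric.tendsto_nhds]
  intro η hη
  have hpi := Real.pi_pos
  obtain ⟨R, hR, hnear⟩ := hu.energyDensity_near hΩ hx₀ hsub hgrowth
    (δ := η / (2 * Real.pi)) (by positivity)
  filter_upwards [Ioo_mem_nhdsGT hR] with r hr
  have hr0 := hr.1
  have hbound : ∀ x ∈ halfBall x₀ r,
      ‖energyDensity fl Ω u x - c * x 0‖ ≤ η / (2 * Real.pi) * r := by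
    intro x hx
    refine (hnear x ⟨hx.1, Metric.ball_subset_ball hr.2.le hx.2⟩).trans ?_
    exact mul_le_mul_of_nonneg_left (le_of_lt hx.2) (by positivity)
  have hmeas0 : Measurable fun x : Plane => c * x 0 := by fun_prop
  have hint0 : IntegrableOn (fun x : Plane => c * x 0) (halfBall x₀ r) := by
    refine Measure.integrableOn_of_bounded (M := |c| * r) (volume_halfBall_lt_top x₀ r).ne
      hmeas0.aestronglyMeasurable ?_
    filter_upwards [ae_restrict_mem (measurableSet_halfBall x₀ r)] with x hx
    have h := abs_coord_sub_le x x₀ 0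
    rw [hx₀.2.1, sub_zero] at h
    rw [Real.norm_eq_abs, abs_mul]
    exact mul_le_mul_of_nonneg_left (h.trans (le_of_lt hx.2)) (abs_nonneg c)
  have hintd : IntegrableOn (fun x => energyDensity fl Ω u x - c * x 0) (halfBall x₀ r) := by
    refine Measure.integrableOn_of_bounded (M := η / (2 * Real.pi) * r)
      (volume_halfBall_lt_top x₀ r).ne
      ((hu.measurable_energyDensity hΩ).sub hmeas0).aestronglyMeasurable ?_
    filter_upwards [ae_restrict_mem (measurableSet_halfBall x₀ r)] with x hx using hbound x hx
  have hint : IntegrableOn (energyDensity fl Ω u) (halfBall x₀ r) := by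
    exact (hintd.add hint0).congr_fun (fun x _ => sub_add_cancel _ _) (measurableSet_halfBall x₀ r)
  have hdiff : energyI fl Ω u x₀ r - c * (2 / 3 * r ^ 3) =
      ∫ x in halfBall x₀ r, (energyDensity fl Ω u x - c * x 0) := by
    rw [integral_sub hint hint0, integral_const_mul, integral_halfBall_fst hx₀.2.1 hr0.le]
    rfl
  have hle : |energyI fl Ω u x₀ r - c * (2 / 3 * r ^ 3)| ≤ η / 2 * r ^ 3 := by
    rw [hdiff, ← Real.norm_eq_abs]
    refine (norm_setIntegral_le_of_norm_le_const (volume_halfBall_lt_top x₀ r) hbound).trans ?_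
    refine (mul_le_mul_of_nonneg_left (volume_real_halfBall_le x₀ hr0.le) (by positivity)).trans_eq
      ?_
    field_simp
  rw [Real.dist_eq, show energyI fl Ω u x₀ r / r ^ 3 - c * (2 / 3)
    = (energyI fl Ω u x₀ r - c * (2 / 3 * r ^ 3)) / r ^ 3 by field_simp, abs_div,
    abs_of_pos (by positivity : 0 < r ^ 3), div_lt_iff₀ (by positivity)]
  refine hle.trans_lt (mul_lt_mul_of_pos_right (by linarith) (by positivity))

lemma integral_cos_pow_three :
    ∫ θ in (-(Real.pi / 2))..(Real.pi / 2), Real.cos θ ^ 3 = 4 / 3 := by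
  rw [integral_cos_pow 1]
  simp
  norm_num

lemma IsVariationalSolution.tendsto_energyJ (hΩ : IsHalfPlaneDomain Ω)
    (hu : IsVariationalSolution fl Ω u) (hx₀ : x₀ ∈ axisPoints Ω u) (hgrowth : GrowthAt Ω u x₀) :
    Tendsto (fun r => energyJ fl u x₀ r / r ^ 4) (𝓝[>] 0) (𝓝 (x₀ 1 / (3 * fl.rho0))) := by
  have hρ := fl.rho0_pos
  have hpi := Real.pi_pos
  set l := √(x₀ 1) with hl_def
  have hl : 0 < l := Real.sqrt_pos.2 hx₀.2.2
  have hlsq : l ^ 2 = x₀ 1 := Real.sq_sqrt hx₀.2.2.le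
  have hle : -(Real.pi / 2) ≤ Real.pi / 2 := by linarith
  obtain ⟨R₁, hR₁, hRΩ⟩ := exists_ball_inter_subset hΩ hx₀.1.1
  obtain ⟨R₂, hR₂, hupper⟩ := hu.le_quadratic hΩ hx₀ hgrowth one_pos
  have hcos : ∀ θ ∈ Icc (-(Real.pi / 2)) (Real.pi / 2), 0 ≤ Real.cos θ :=
    fun θ hθ => Real.cos_nonneg_of_mem_Icc hθ
  have harc : ∀ r ∈ Ioo 0 R₁, ∀ θ ∈ Icc (-(Real.pi / 2)) (Real.pi / 2),
      arcPoint x₀ r θ ∈ Ω := by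
    intro r hr θ hθ
    refine hRΩ ⟨?_, ?_⟩
    · rw [Metric.mem_ball, dist_arcPoint x₀ hr.1.le]
      exact hr.2
    · rw [mem_ofPred_eq, arcPoint_zero hx₀.2.1]
      exact mul_nonneg hr.1.le (hcos θ hθ)
  have hlim : Tendsto (fun r => ∫ θ in (-(Real.pi / 2))..(Real.pi / 2),
      (u (arcPoint x₀ r θ) / r ^ 2) ^ 2 / (Real.cos θ * fl.rho0)) (𝓝[>] 0)
      (𝓝 (∫ θ in (-(Real.pi / 2))..(Real.pi / 2),
        (l * Real.cos θ ^ 2 / 2) ^ 2 / (Real.cos θ * fl.rho0))) := by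
    refine intervalIntegral.tendsto_integral_filter_of_dominated_convergence
      (fun _ => ((l + 1) / 2) ^ 2 / fl.rho0) ?_ ?_ intervalIntegrable_const ?_
    · filter_upwards [Ioo_mem_nhdsGT hR₁] with r hr
      rw [uIoc_of_le hle]
      have hu' : ContinuousOn (fun θ => u (arcPoint x₀ r θ)) (Icc (-(Real.pi / 2)) (Real.pi / 2)) :=
        hu.continuousOn.comp (by unfold arcPoint; fun_prop) (harc r hr)
      have hm : AEStronglyMeasurable (fun θ => (u (arcPoint x₀ r θ) / r ^ 2) ^ 2)
          (volume.restrict (Ioc (-(Real.pi / 2)) (Real.pi / 2))) :=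
        (((hu'.div_const _).pow 2).mono Ioc_subset_Icc_self).aestronglyMeasurable measurableSet_Ioc
      exact (hm.aemeasurable.div (by fun_prop)).aestronglyMeasurable
    · filter_upwards [Ioo_mem_nhdsGT hR₁, Ioo_mem_nhdsGT hR₂] with r hr hr'
      refine ae_of_all _ fun θ hθ => ?_
      rw [uIoc_of_le hle] at hθ
      have hθ' := Ioc_subset_Icc_self hθ
      have hc0 := hcos θ hθ'
      have hc1 := Real.cos_le_one θ
      have hr0 := hr.1
      have hu0 := hu.nonneg _ (harc r hr θ hθ')
      have hu1 := hupper (arcPoint x₀ r θ)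
        (by rw [Metric.mem_ball, dist_arcPoint x₀ hr0.le]; exact hr'.2)
        (by rw [arcPoint_zero hx₀.2.1]; positivity)
      rw [arcPoint_zero hx₀.2.1] at hu1
      have hv : u (arcPoint x₀ r θ) / r ^ 2 ≤ (l + 1) / 2 * Real.cos θ ^ 2 := by
        rw [div_le_iff₀ (by positivity)]
        linarith
      rw [Real.norm_of_nonneg (by positivity)]
      rcases hc0.eq_or_lt with hc | hc
      · rw [← hc, zero_mul, div_zero]
        positivity
      rw [div_le_div_iff₀ (by positivity) hρ]
      have hsq := pow_le_pow_left₀ (by positivity) hv 2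
      have h4 : Real.cos θ ^ 4 ≤ Real.cos θ := by
        simpa using pow_le_pow_of_le_one hc0 hc1 (show 1 ≤ 4 by norm_num)
      calc (u (arcPoint x₀ r θ) / r ^ 2) ^ 2 * fl.rho0
          ≤ ((l + 1) / 2 * Real.cos θ ^ 2) ^ 2 * fl.rho0 := mul_le_mul_of_nonneg_right hsq hρ.le
        _ = ((l + 1) / 2) ^ 2 * fl.rho0 * Real.cos θ ^ 4 := by ring
        _ ≤ ((l + 1) / 2) ^ 2 * fl.rho0 * Real.cos θ := mul_le_mul_of_nonneg_left h4 (by positivity)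
        _ = _ := by ring
    · refine ae_of_all _ fun θ hθ => ?_
      rw [uIoc_of_le hle] at hθ
      have hc0 := hcos θ (Ioc_subset_Icc_self hθ)
      refine Tendsto.div_const (Tendsto.pow ?_ 2) _
      rw [Metric.tendsto_nhds]
      intro η hη
      obtain ⟨R, hR, hprof⟩ := hu.abs_sub_quadratic_le hΩ hx₀ hgrowth (half_pos hη)
      filter_upwards [Ioo_mem_nhdsGT hR] with r hr
      have hr0 := hr.1
      have h := hprof (arcPoint x₀ r θ)
        (by rw [Metric.mem_ball, dist_arcPoint x₀ hr0.le]; exact hr.2)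
        (by rw [arcPoint_zero hx₀.2.1]; positivity)
      rw [dist_arcPoint x₀ hr0.le, arcPoint_zero hx₀.2.1] at h
      rw [Real.dist_eq, show u (arcPoint x₀ r θ) / r ^ 2 - l * Real.cos θ ^ 2 / 2
        = (u (arcPoint x₀ r θ) - l * (r * Real.cos θ) ^ 2 / 2) / r ^ 2 by field_simp, abs_div,
        abs_of_pos (by positivity : 0 < r ^ 2), div_lt_iff₀ (by positivity)]
      exact h.trans_lt (mul_lt_mul_of_pos_right (half_lt_self hη) (by positivity))
  have hval : ∫ θ in (-(Real.pi / 2))..(Real.pi / 2),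
      (l * Real.cos θ ^ 2 / 2) ^ 2 / (Real.cos θ * fl.rho0) = x₀ 1 / (3 * fl.rho0) := by
    have hfun : (fun θ => (l * Real.cos θ ^ 2 / 2) ^ 2 / (Real.cos θ * fl.rho0)) =
        fun θ => x₀ 1 / (4 * fl.rho0) * Real.cos θ ^ 3 := by
      funext θ
      rcases eq_or_ne (Real.cos θ) 0 with hc | hc
      · simp [hc]
      · rw [← hlsq]
        field_simp
        norm_num
    rw [hfun, intervalIntegral.integral_const_mul, integral_cos_pow_three]
    field_simp
  rw [hval] at hlim
  refine hlim.congr' ?_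
  filter_upwards [self_mem_nhdsWithin] with r hr
  have hr0 : r ≠ 0 := (show 0 < r from hr).ne'
  rw [energyJ, ← intervalIntegral.integral_div]
  refine intervalIntegral.integral_congr fun θ _ => ?_
  simp only [arcPoint_zero hx₀.2.1]
  rcases eq_or_ne (Real.cos θ) 0 with hc | hc
  · simp [hc]
  · field_simp

/-- Under the growth assumption, the density at a non-stagnation axis point is `2/3`. -/
lemma IsVariationalSolution.tendsto_weissM (hΩ : IsHalfPlaneDomain Ω)
    (hu : IsVariationalSolution fl Ω u) (hx₀ : x₀ ∈ axisPoints Ω u)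
    (hsub : x₀ 1 < fl.stagnationHeight) (hgrowth : GrowthAt Ω u x₀) :
    Tendsto (weissM fl Ω u x₀) (𝓝[>] 0) (𝓝 (2 * x₀ 1 / (3 * fl.rho0))) := by
  have h := (hu.tendsto_energyI hΩ hx₀ hsub hgrowth).sub
    ((hu.tendsto_energyJ hΩ hx₀ hgrowth).const_mul 2)
  have hρ := fl.rho0_pos
  convert h using 1
  · funext r
    rw [weissM]
    ring
  · congr 1
    field_simp
    ring

end Domain

/-! ### The free boundary curve -/

lemma forall_pos_or_forall_neg {f : ℝ → ℝ} {s : Set ℝ} (hs : IsPreconnected s)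
    (hc : ContinuousOn f s) (hne : ∀ t ∈ s, f t ≠ 0) :
    (∀ t ∈ s, 0 < f t) ∨ ∀ t ∈ s, f t < 0 := by
  by_contra! h
  obtain ⟨⟨a, ha, hfa⟩, b, hb, hfb⟩ := h
  obtain ⟨t, ht, hft⟩ := hs.intermediate_value ha hb hc ⟨hfa, hfb⟩
  exact hne t ht hft

/-- A continuous function with a strict local minimum at `0` takes some value on both sides. -/
lemma exists_eq_of_pos_both_sides {f : ℝ → ℝ} {T : ℝ} (hT : 0 < T)
    (hc : ContinuousOn f (Ioo (-T) T)) (h0 : f 0 = 0) (hneg : ∀ t ∈ Ioo (-T) 0, 0 < f t)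
    (hpos : ∀ t ∈ Ioo 0 T, 0 < f t) : ∃ s ∈ Ioo (-T) 0, ∃ t ∈ Ioo 0 T, f s = f t := by
  have ha := hneg (-(T / 2)) ⟨by linarith, by linarith⟩
  have hb := hpos (T / 2) ⟨by linarith, by linarith⟩
  have hv : 0 < min (f (-(T / 2))) (f (T / 2)) := lt_min ha hb
  obtain ⟨s, hs, hfs⟩ := intermediate_value_Icc' (by linarith : -(T / 2) ≤ 0)
    (hc.mono fun x hx => ⟨by linarith [hx.1], by linarith [hx.2]⟩)
    ⟨h0.trans_le hv.le, min_le_left _ _⟩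
  obtain ⟨t, ht, hft⟩ := intermediate_value_Icc (by linarith : 0 ≤ T / 2)
    (hc.mono fun x hx => ⟨by linarith [hx.1], by linarith [hx.2]⟩)
    ⟨h0.trans_le hv.le, min_le_right _ _⟩
  refine ⟨s, ⟨by linarith [hs.1], hs.2.lt_of_ne ?_⟩, t,
    ⟨ht.1.lt_of_ne ?_, by linarith [ht.2]⟩, hfs.trans hft.symm⟩
  · rintro rfl
    exact hv.ne (h0.symm.trans hfs)
  · rintro rfl
    exact hv.ne (h0.symm.trans hft)

section Curve

variable {Ω : Set Plane} {u : Plane → ℝ} {x₀ : Plane} {fl : Fluid} {I : Set ℝ} {σ : ℝ → Plane}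

lemma IsFreeBoundaryCurve.eventually_mem_ball (hσ : IsFreeBoundaryCurve Ω u x₀ I σ) {R : ℝ}
    (hR : 0 < R) : ∀ᶠ t in 𝓝[I] 0, σ t ∈ Metric.ball x₀ R := by
  have h := hσ.continuousOn 0 hσ.zero_mem
  rw [ContinuousWithinAt, hσ.map_zero] at h
  exact h (Metric.ball_mem_nhds x₀ hR)

lemma IsFreeBoundaryCurve.eventually_mem_freeBoundary (hσ : IsFreeBoundaryCurve Ω u x₀ I σ) :
    ∀ᶠ t in 𝓝[I] 0, t ≠ 0 → σ t ∈ freeBoundary Ω u ∧ 0 < σ t 0 := by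
  obtain ⟨r, hr, himage⟩ := hσ.image
  filter_upwards [hσ.eventually_mem_ball hr, self_mem_nhdsWithin] with t ht htI hne
  have hmem : σ t ∈ insert x₀ (freeBoundary Ω u ∩ {x | 0 < x 0}) ∩ Metric.ball x₀ r :=
    himage ▸ ⟨mem_image_of_mem σ htI, ht⟩
  rcases hmem.1 with heq | h
  · exact absurd (hσ.injOn htI hσ.zero_mem (heq.trans hσ.map_zero.symm)) hne
  · exact h

lemma notMem_posSet_of_mem_freeBoundary (hΩ : IsHalfPlaneDomain Ω)
    (hu : IsVariationalSolution fl Ω u) {x : Plane} (hx : x ∈ freeBoundary Ω u) :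
    x ∉ posSet Ω u := fun h => hx.2.2 ((hu.isOpen_posSet hΩ).interior_eq.symm ▸ h)

/-- The curve approaches the axis tangentially, since free boundary points avoid every cone
around `e₁` that is contained in the fluid phase near `x°`. -/
lemma IsFreeBoundaryCurve.eventually_le (hΩ : IsHalfPlaneDomain Ω)
    (hu : IsVariationalSolution fl Ω u) (hx₀ : x₀ ∈ axisPoints Ω u) (hgrowth : GrowthAt Ω u x₀)
    (hσ : IsFreeBoundaryCurve Ω u x₀ I σ) {κ : ℝ} (hκ : 0 < κ) :
    ∀ᶠ t in 𝓝[I] 0, t ≠ 0 → 0 < σ t 0 ∧ σ t 0 ≤ κ * |σ t 1 - x₀ 1| := by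
  obtain ⟨R, hR, hcone⟩ := hu.mem_posSet_of_mem_cone hΩ hx₀ hgrowth hκ
  filter_upwards [hσ.eventually_mem_ball hR, hσ.eventually_mem_freeBoundary] with t hball hfb hne
  refine ⟨(hfb hne).2, ?_⟩
  by_contra! h
  exact notMem_posSet_of_mem_freeBoundary hΩ hu (hfb hne).1 (hcone _ hball h)

lemma IsFreeBoundaryCurve.eventually_ne (hΩ : IsHalfPlaneDomain Ω)
    (hu : IsVariationalSolution fl Ω u) (hx₀ : x₀ ∈ axisPoints Ω u) (hgrowth : GrowthAt Ω u x₀)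
    (hσ : IsFreeBoundaryCurve Ω u x₀ I σ) : ∀ᶠ t in 𝓝[I] 0, t ≠ 0 → σ t 1 ≠ x₀ 1 := by
  filter_upwards [hσ.eventually_le hΩ hu hx₀ hgrowth one_pos] with t ht hne heq
  have := ht hne
  rw [heq, sub_self, abs_zero, mul_zero] at this
  linarith [this.1, this.2]

lemma IsFreeBoundaryCurve.tendsto_ratio (hΩ : IsHalfPlaneDomain Ω)
    (hu : IsVariationalSolution fl Ω u) (hx₀ : x₀ ∈ axisPoints Ω u) (hgrowth : GrowthAt Ω u x₀)
    (hσ : IsFreeBoundaryCurve Ω u x₀ I σ) :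
    Tendsto (fun t => σ t 0 / (σ t 1 - x₀ 1)) (𝓝[I \ {0}] 0) (𝓝 0) := by
  rw [Metric.tendsto_nhds]
  intro η hη
  have hle : 𝓝[I \ {0}] (0 : ℝ) ≤ 𝓝[I] 0 := nhdsWithin_mono _ sdiff_subset
  filter_upwards [hle (hσ.eventually_le hΩ hu hx₀ hgrowth (half_pos hη)),
    hle (hσ.eventually_ne hΩ hu hx₀ hgrowth), self_mem_nhdsWithin] with t ht hne htI
  obtain ⟨h0, h1⟩ := ht htI.2
  have habs : 0 < |σ t 1 - x₀ 1| := abs_pos.2 (sub_ne_zero.2 (hne htI.2))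
  rw [Real.dist_eq, sub_zero, abs_div, abs_of_pos h0, div_lt_iff₀ habs]
  exact h1.trans_lt (mul_lt_mul_of_pos_right (half_lt_self hη) habs)

/-- Near `x°`, every horizontal line meets the free boundary off the axis at most once, since to the
right of a free boundary point there is only fluid. -/
lemma IsVariationalSolution.freeBoundary_slice_subsingleton (hΩ : IsHalfPlaneDomain Ω)
    (hu : IsVariationalSolution fl Ω u) (hx₀ : x₀ ∈ axisPoints Ω u) (hgrowth : GrowthAt Ω u x₀) :
    ∃ R > 0, ∀ y ∈ Metric.ball x₀ R ∩ freeBoundary Ω u, ∀ z ∈ Metric.ball x₀ R ∩ freeBoundary Ω u,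
      y 1 = z 1 → y = z := by
  obtain ⟨R, hR, -, hcone⟩ := hu.closure_posSet_cone hΩ hx₀ hgrowth one_pos
  have hle : ∀ y ∈ Metric.ball x₀ R ∩ freeBoundary Ω u,
      ∀ z ∈ Metric.ball x₀ R ∩ freeBoundary Ω u, y 1 = z 1 → z 0 ≤ y 0 := by
    intro y hy z hz h1
    by_contra! hlt
    refine notMem_posSet_of_mem_freeBoundary hΩ hu hz.2
      (hcone y ⟨hy.1, frontier_subset_closure hy.2.2⟩ z hz.1 ?_)
    rw [h1, sub_self, abs_zero, mul_zero]
    exact sub_pos.2 hlt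
  refine ⟨R, hR, fun y hy z hz h1 => ?_⟩
  rw [← eq_vec y, ← eq_vec z, h1, le_antisymm (hle z hz y hy h1.symm) (hle y hy z hz h1)]

/-- At a non-stagnation axis point, the free boundary curve is tangent to the axis: it either ends
there or passes from one side of the height of the point to the other. -/
theorem IsFreeBoundaryCurve.cusp (hΩ : IsHalfPlaneDomain Ω)
    (hu : IsVariationalSolution fl Ω u) (hx₀ : x₀ ∈ axisPoints Ω u) (hgrowth : GrowthAt Ω u x₀)
    (hσ : IsFreeBoundaryCurve Ω u x₀ I σ) :
    ∃ t₁ : ℝ, 0 < t₁ ∧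
      ((I ⊆ Ici 0 ∧ Ioo 0 t₁ ⊆ I ∧
          (∀ t ∈ Ioo 0 t₁, σ t 1 ≠ x₀ 1) ∧
          Tendsto (fun t => σ t 0 / (σ t 1 - x₀ 1)) (𝓝[>] 0) (𝓝 0)) ∨
        (Ioo (-t₁) t₁ ⊆ I ∧
          (∀ t ∈ Ioo (-t₁) t₁ \ {0}, σ t 1 ≠ x₀ 1) ∧
          (((∀ t ∈ Ioo (-t₁) 0, σ t 1 - x₀ 1 < 0) ∧ ∀ t ∈ Ioo 0 t₁, 0 < σ t 1 - x₀ 1) ∨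
            ((∀ t ∈ Ioo (-t₁) 0, 0 < σ t 1 - x₀ 1) ∧ ∀ t ∈ Ioo 0 t₁, σ t 1 - x₀ 1 < 0)) ∧
          Tendsto (fun t => σ t 0 / (σ t 1 - x₀ 1)) (𝓝[≠] 0) (𝓝 0))) := by
  have hratio := hσ.tendsto_ratio hΩ hu hx₀ hgrowth
  obtain ⟨R, hR, hslice⟩ := hu.freeBoundary_slice_subsingleton hΩ hx₀ hgrowth
  obtain ⟨τ, hτ, hnear⟩ := Metric.mem_nhdsWithin_iff.1
    ((hσ.eventually_ne hΩ hu hx₀ hgrowth).and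
      ((hσ.eventually_mem_ball hR).and hσ.eventually_mem_freeBoundary))
  have hball : ∀ t ∈ Ioo (-τ) τ, t ∈ Metric.ball (0 : ℝ) τ := fun t ht => by
    rw [Real.ball_eq_Ioo, zero_sub, zero_add]
    exact ht
  obtain ⟨b, hbI, hb⟩ := hσ.exists_pos
  by_cases hI : I ⊆ Ici 0
  · have hsub : Ioo 0 (min b τ) ⊆ I := fun t ht =>
      hσ.interval.out hσ.zero_mem hbI ⟨ht.1.le, ht.2.le.trans (min_le_left _ _)⟩
    refine ⟨min b τ, lt_min hb hτ, Or.inl ⟨hI, hsub, fun t ht => ?_, hratio.mono_left ?_⟩⟩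
    · exact (hnear ⟨hball t ⟨by linarith [ht.1], ht.2.trans_le (min_le_right _ _)⟩,
        hsub ht⟩).1 ht.1.ne'
    · refine nhdsWithin_le_of_mem ?_
      filter_upwards [Ioo_mem_nhdsGT (lt_min hb hτ)] with t ht using ⟨hsub ht, ht.1.ne'⟩
  · obtain ⟨a, haI, ha⟩ := not_subset.1 hI
    have ha' : 0 < -a := neg_pos.2 (not_le.1 ha)
    set T := min (min (-a) b) τ with hT_def
    have hT : 0 < T := lt_min (lt_min ha' hb) hτ
    have hTa : T ≤ -a := (min_le_left _ _).trans (min_le_left _ _)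
    have hTb : T ≤ b := (min_le_left _ _).trans (min_le_right _ _)
    have hTτ : T ≤ τ := min_le_right _ _
    have hsub : Ioo (-T) T ⊆ I := fun t ht =>
      hσ.interval.out haI hbI ⟨by linarith [ht.1], by linarith [ht.2]⟩
    have hprop : ∀ t ∈ Ioo (-T) T, t ≠ 0 → σ t 1 ≠ x₀ 1 ∧
        σ t ∈ Metric.ball x₀ R ∩ freeBoundary Ω u := by
      intro t ht hne
      have h := hnear ⟨hball t ⟨by linarith [ht.1], by linarith [ht.2]⟩, hsub ht⟩
      exact ⟨h.1 hne, h.2.1, (h.2.2 hne).1⟩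
    have hright : Ioo 0 T ⊆ Ioo (-T) T := Ioo_subset_Ioo_left (by linarith)
    have hleft : Ioo (-T) 0 ⊆ Ioo (-T) T := Ioo_subset_Ioo_right hT.le
    set f : ℝ → ℝ := fun t => σ t 1 - x₀ 1 with hf_def
    have hf : ContinuousOn f (Ioo (-T) T) :=
      ((by fun_prop : Continuous fun x : Plane => x 1).comp_continuousOn
        (hσ.continuousOn.mono hsub)).sub continuousOn_const
    have hf0 : f 0 = 0 := by rw [hf_def]; simp [hσ.map_zero]
    -- Two branches on the same side would meet a common horizontal line.
    have hsame : ¬ ∃ s ∈ Ioo (-T) 0, ∃ t ∈ Ioo 0 T, f s = f t := by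
      rintro ⟨s, hs, t, ht, hst⟩
      have heq := hslice _ (hprop s (hleft hs) hs.2.ne).2 _ (hprop t (hright ht) ht.1.ne').2
        (sub_left_injective hst)
      have := hσ.injOn (hsub (hleft hs)) (hsub (hright ht)) heq
      linarith [hs.2, ht.1]
    refine ⟨T, hT, Or.inr ⟨hsub, fun t ht => (hprop t ht.1 ht.2).1, ?_, hratio.mono_left ?_⟩⟩
    · rcases forall_pos_or_forall_neg isPreconnected_Ioo (hf.mono hleft) fun t ht =>
        sub_ne_zero.2 (hprop t (hleft ht) ht.2.ne).1 with hl | hl <;>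
      rcases forall_pos_or_forall_neg isPreconnected_Ioo (hf.mono hright) fun t ht =>
        sub_ne_zero.2 (hprop t (hright ht) ht.1.ne').1 with hr | hr
      · exact absurd (exists_eq_of_pos_both_sides hT hf hf0 hl hr) hsame
      · exact Or.inr ⟨hl, hr⟩
      · exact Or.inl ⟨hl, hr⟩
      · refine absurd ?_ hsame
        obtain ⟨s, hs, t, ht, hst⟩ := exists_eq_of_pos_both_sides (f := fun t => -f t) hT hf.neg
          (by simp [hf0]) (fun t ht => neg_pos.2 (hl t ht)) fun t ht => neg_pos.2 (hr t ht)
        exact ⟨s, hs, t, ht, neg_injective hst⟩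
    · refine nhdsWithin_le_of_mem ?_
      filter_upwards [nhdsWithin_le_nhds (Ioo_mem_nhds (neg_lt_zero.2 hT) hT),
        self_mem_nhdsWithin] with t ht hne using ⟨hsub ht, hne⟩

end Curve

end AxisFlow

theorem proposition6p5 (fl : AxisFlow.Fluid) (Ω : Set AxisFlow.Plane)
    (hΩ : AxisFlow.IsHalfPlaneDomain Ω) (u : AxisFlow.Plane → ℝ)
    (hu : AxisFlow.IsWeakSolution fl Ω u)
    (x₀ : AxisFlow.Plane) (hx₀ : x₀ ∈ AxisFlow.axisPoints Ω u)
    (hsub : x₀ 1 < fl.stagnationHeight)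
    (hgrowth : AxisFlow.GrowthAt Ω u x₀)
    (I : Set ℝ) (σ : ℝ → AxisFlow.Plane)
    (hσ : AxisFlow.IsFreeBoundaryCurve Ω u x₀ I σ) :
    (Tendsto (AxisFlow.weissM fl Ω u x₀) (𝓝[>] 0) (𝓝 (2 * x₀ 1 / (3 * fl.rho0))) →
      ∃ t₁ : ℝ, 0 < t₁ ∧
        ((I ⊆ Ici 0 ∧ Ioo 0 t₁ ⊆ I ∧
            (∀ t ∈ Ioo 0 t₁, σ t 1 ≠ x₀ 1) ∧
            Tendsto (fun t => σ t 0 / (σ t 1 - x₀ 1)) (𝓝[>] 0) (𝓝 0)) ∨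
          (Ioo (-t₁) t₁ ⊆ I ∧
            (∀ t ∈ Ioo (-t₁) t₁ \ {0}, σ t 1 ≠ x₀ 1) ∧
            (((∀ t ∈ Ioo (-t₁) 0, σ t 1 - x₀ 1 < 0) ∧ ∀ t ∈ Ioo 0 t₁, 0 < σ t 1 - x₀ 1) ∨
              ((∀ t ∈ Ioo (-t₁) 0, 0 < σ t 1 - x₀ 1) ∧ ∀ t ∈ Ioo 0 t₁, σ t 1 - x₀ 1 < 0)) ∧
            Tendsto (fun t => σ t 0 / (σ t 1 - x₀ 1)) (𝓝[≠] 0) (𝓝 0)))) ∧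
    (Tendsto (AxisFlow.weissM fl Ω u x₀) (𝓝[>] 0) (𝓝 0) →
      ∃ t₁ : ℝ, 0 < t₁ ∧ Ioo (-t₁) t₁ ⊆ I ∧
        (∀ t ∈ Ioo (-t₁) t₁ \ {0}, σ t 1 ≠ x₀ 1) ∧
        Tendsto (fun t => σ t 0 / (σ t 1 - x₀ 1)) (𝓝[≠] 0) (𝓝 0)) := by
  have hv := hu.toIsVariationalSolution
  refine ⟨fun _ => hσ.cusp hΩ hv hx₀ hgrowth, fun h => ?_⟩
  -- The density is `2/3`, so density `0` does not occur.
  have hlim := tendsto_nhds_unique h (hv.tendsto_weissM hΩ hx₀ hsub hgrowth)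
  have hpos : 0 < 2 * x₀ 1 / (3 * fl.rho0) :=
    div_pos (mul_pos two_pos hx₀.2.2) (mul_pos three_pos fl.rho0_pos)
  exact absurd hlim hpos.ne
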